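/- **Proposition (Flip Property).** Let $0\le t<1$. A signature $\lambda\in\mathrm{Sig}_N$ is a sequence of integers $\lambda_1\ge\dots\ge\lambda_N$; put $|\lambda|=\sum_i\lambda_i$, $-\lambda=(-\lambda_N,\dots,-\lambda_1)$, $\lambda_0=+\infty$, $\lambda_k=-\infty$ for $k>N$. A Young diagram is regarded as the sequence of its row lengths continued by zeros, with $\lambda_0=+\infty$. Write $\lambda\prec\mu$ if $\mu_1\ge\lambda_1\ge\mu_2\ge\lambda_2\ge\cdots$ (for signatures, the length of $\mu$ is that of $\lambda$ or one more). For two signatures or two Young diagrams set $$\psi_{\mu/\lambda}=\mathbf 1_{\lambda\prec\mu}\prod_{1\le k\le j\le \ell:\ \mu_{j+1}<\lambda_j=\lambda_k<\mu_k}(1-t^{j-k+1}),\qquad \phi_{\mu/\lambda}=\mathbf 1_{\lambda\prec\mu}\prod_{1\le k\le j\le \ell:\ \lambda_j<\mu_j=\mu_k<\lambda_{k-1}}(1-t^{j-k+1}),$$ where $\ell$ is the length of the signature $\mu$, respectively the number of rows of the diagram $\mu$. *The weight $U$.* Let $\lambda,\mu,\nu,\rho\in\mathrm{Sig}_N$.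 If $\lambda\prec\mu\prec\rho$, $\lambda\prec\nu\prec\rho$ and $|\nu|-|\lambda|=|\rho|-|\mu|$, let $m=|\nu|-|\lambda|$, $n=|\mu|-|\lambda|$. An admissible function is a map $\Lambda:\{0,\dots,m\}\times\{0,\dots,n\}\to\mathrm{Sig}_N$ with $\Lambda(0,0)=\lambda$, $\Lambda(m,0)=\nu$, $\Lambda(0,n)=\mu$, $\Lambda(m,n)=\rho$ such that, regarding signatures as $N$ particles on $\mathbb Z$: $\Lambda(i+1,j)$ is obtained from $\Lambda(i,j)$ by moving one particle from a position $h_{i,j}$ to $h_{i,j}+1$; $\Lambda(i,j+1)$ is obtained from $\Lambda(i,j)$ by moving one particle from a position $v_{i,j}$ to $v_{i,j}+1$; $h_{i,j}<h_{i+1,j}$ and $v_{i,j}<v_{i,j+1}$; and if $h_{i,j}=v_{i,j}=k$, then $h_{i,j+1}=v_{i+1,j}\in\{k,k+1\}$. There is at most one admissible function. The box $b_{i,j}$ with south-western corner $(i,j)$ is a zero-box if $h_{i,j}=v_{i,j}=h_{i,j+1}=v_{i+1,j}$, a one-box if $h_{i,j}=v_{i,j}=h_{i,j+1}-1=v_{i+1,j}-1$,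 and trivial if $h_{i,j}=h_{i,j+1}\ne v_{i,j}=v_{i+1,j}$ or if it lies outside the rectangle. For a zero- or one-box $B=b_{i,j}$ let $r(B)=h_{i,j}$, $\bar r(B)=h_{i,j+1}$, and let $c(B)=t^{d}$, where $d$ is the number of coordinates of $\Lambda(i,j)$ equal to $r(B)$; put $h_{-1,j}=v_{i,-1}=-\infty$. The weight $w(B)$ is: 1. $1$, if $B$ is trivial; or $B$ is a one-box and $b_{i-1,j}$ or $b_{i,j-1}$ is a one-box; or $B$ and $b_{i-1,j-1}$ are both one-boxes, or both zero-boxes, with $\bar r(b_{i-1,j-1})=r(B)-1$; 2. $t$, if $B$ is a zero-box and exactly one of $h_{i-1,j},v_{i,j-1}$ equals $r(B)-1$; 3. $1-t$, if $B$ is a one-box, $b_{i-1,j},b_{i,j-1}$ are trivial and exactly one of $h_{i-1,j},v_{i,j-1}$ equals $r(B)-1$; 4. $\frac{t-c(B)}{1-c(B)}$, if $B$ is a zero-box and $h_{i-1,j},v_{i,j-1}<r(B)-1$; 5. $\frac{1-t}{1-c(B)}$, if $B$ is a one-box and $h_{i-1,j},v_{i,j-1}<r(B)-1$; 6. $0$,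 if one of $B$, $b_{i-1,j-1}$ is a one-box and the other a zero-box, with $\bar r(b_{i-1,j-1})=r(B)-1$. Then $U(\mu\to\rho\mid\lambda\to\nu)=\prod_{i<m,\,j<n}w(b_{i,j})$ if an admissible function exists; in all other cases $U(\mu\to\rho\mid\lambda\to\nu)=0$. *The weights with input.* Let $\lambda,\mu,\nu,\rho$ be Young diagrams and $r\in\mathbb Z_{\ge0}$. If $\lambda\prec\mu\prec\rho$, $\lambda\prec\nu\prec\rho$ and $|\rho|-|\mu|=|\nu|-|\lambda|+r$, regard them as signatures (adding zeros) $\lambda,\nu\in\mathrm{Sig}_{N}$, $\mu,\rho\in\mathrm{Sig}_{N+1}$ for any $N$ for which this is possible, take any integer $a$ strictly smaller than all coordinates of these signatures $\mu$ and $\nu$, put $\tilde\lambda=(\lambda_1,\dots,\lambda_N,a-r)$, $\tilde\nu=(\nu_1,\dots,\nu_N,a)$, and set $$U^r(\mu\to\rho\mid\lambda\to\nu)=U(\mu\to\rho\mid\tilde\lambda\to\tilde\nu),\qquad \hat U^r(\nu\to\lambda\mid\rho\to\mu)=U(-\tilde\nu\to-\tilde\lambda\mid-\rho\to-\mu).$$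 Otherwise both are $0$. *Claim.* (1) For all $N\ge 0$ and $\lambda,\mu,\nu,\rho\in\mathrm{Sig}_N$, $$U(\mu\to\rho\mid\lambda\to\nu)\,\frac{\phi_{\nu/\lambda}\psi_{\mu/\lambda}}{\phi_{\rho/\mu}\psi_{\rho/\nu}}=U(-\nu\to-\lambda\mid-\rho\to-\mu),$$ where $\phi_{\rho/\mu}\psi_{\rho/\nu}\neq0$ whenever $\mu\prec\rho$ and $\nu\prec\rho$ (if one of these fails, both values of $U$ are $0$, and the left-hand side is read as $0$). (2) For all Young diagrams $\lambda,\mu,\nu,\rho$ and all $r\in\mathbb Z_{\ge0}$, $$(1-t\mathbf 1_{r\ge1})\,\phi_{\nu/\lambda}\psi_{\mu/\lambda}\,U^r(\mu\to\rho\mid\lambda\to\nu)=\phi_{\rho/\mu}\psi_{\rho/\nu}\,\hat U^r(\nu\to\lambda\mid\rho\to\mu),$$ for every choice of $N$ and $a$ in the definition of $U^r$ and $\hat U^r$. -/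

import Mathlib

namespace HLRSK

/-- Integers extended by `-∞` (`⊥`) and `+∞` (`⊤`). -/
abbrev ExtInt : Type := WithBot (WithTop ℤ)

/-- Signatures of length `N`: non-increasing sequences of `N` integers.
The part `λ_k` (`1 ≤ k ≤ N`) is `part ⟨k - 1, _⟩`. -/
structure Sig (N : ℕ) where
  part : Fin N → ℤ
  anti : Antitone part

namespace Sig

variable {N : ℕ}

/-- `|λ|`, the sum of the parts. -/
def size (lam : Sig N) : ℤ := ∑ i, lam.part i

/-- The reversed signature `-λ = (-λ_N, …, -λ_1)`. -/
def neg (lam : Sig N) : Sig N where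
  part i := -lam.part i.rev
  anti := fun _ _ h => neg_le_neg (lam.anti (Fin.rev_le_rev.mpr h))

/-- The signature `(λ_1, …, λ_N, a)`, for `a` not larger than any part of `λ`. -/
def append (lam : Sig N) (a : ℤ) (ha : ∀ i, a ≤ lam.part i) : Sig (N + 1) where
  part := Fin.snoc (α := fun _ => ℤ) lam.part a
  anti := by
    intro i j hij
    induction j using Fin.lastCases with
    | last =>
      induction i using Fin.lastCases with
      | last => exact le_rfl
      | cast i => simpa using ha i
    | cast j =>
      induction i using Fin.lastCases with
      | last => exact absurd hij (not_le.mpr (Fin.castSucc_lt_last j))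
      | cast i => simpa using lam.anti (by simpa using hij)

/-- The sequence `λ_0 = +∞, λ_1, …, λ_N, λ_{N+1} = -∞, λ_{N+2} = -∞, …`. -/
def ext (lam : Sig N) (k : ℕ) : ExtInt :=
  if k = 0 then ⊤
  else if h : k - 1 < N then ((lam.part ⟨k - 1, h⟩ : ℤ) : WithTop ℤ) else ⊥

/-- The number of coordinates of `λ` equal to `a`. -/
def count (lam : Sig N) (a : ℤ) : ℕ := (Finset.univ.filter fun i => lam.part i = a).card

/-- `lam'` is obtained from `lam`, seen as `N` particles on `ℤ`,
by moving one particle from position `a` to position `a + 1`. -/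
def Moves (lam lam' : Sig N) (a : ℤ) : Prop :=
  ∃ i, lam.part i = a ∧ lam'.part = Function.update lam.part i (a + 1)

end Sig

/-- A Young diagram as the sequence `λ_0 = +∞, λ_1, λ_2, …` of its row lengths, continued by
zeros. -/
def youngExt (lam : YoungDiagram) (k : ℕ) : ExtInt :=
  if k = 0 then ⊤ else ((lam.rowLen (k - 1) : ℤ) : WithTop ℤ)

/-- A Young diagram with at most `N` rows as a signature of length `N`. -/
def youngSig (lam : YoungDiagram) (N : ℕ) : Sig N where
  part i := lam.rowLen i
  anti := fun _ _ h => Int.ofNat_le.mpr (lam.rowLen_anti _ _ h)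

/-- Interlacing `a ≺ b`: `b_1 ≥ a_1 ≥ b_2 ≥ a_2 ≥ …`. -/
def SeqInterlace (a b : ℕ → ExtInt) : Prop := ∀ k, 1 ≤ k → a k ≤ b k ∧ b (k + 1) ≤ a k

/-- Interlacing `λ ≺ μ` of signatures. By the conventions for parts with index larger than the
length, it can hold only for `μ` of the same length as `λ` or longer by one. -/
def Interlace {N M : ℕ} (lam : Sig N) (mu : Sig M) : Prop := SeqInterlace lam.ext mu.ext

open Classical in
/-- `1_{a ≺ b} ∏ (1 - t ^ (j - k + 1))` over `1 ≤ k ≤ j ≤ M` with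
`b_{j+1} < a_j = a_k < b_k`. -/
noncomputable def psiSeq (t : ℝ) (M : ℕ) (b a : ℕ → ExtInt) : ℝ :=
  if SeqInterlace a b then
    ∏ j ∈ Finset.Icc 1 M, ∏ k ∈ Finset.Icc 1 j,
      if b (j + 1) < a j ∧ a j = a k ∧ a k < b k then 1 - t ^ (j - k + 1) else 1
  else 0

open Classical in
/-- `1_{a ≺ b} ∏ (1 - t ^ (j - k + 1))` over `1 ≤ k ≤ j ≤ M` with
`a_j < b_j = b_k < a_{k-1}`. -/
noncomputable def phiSeq (t : ℝ) (M : ℕ) (b a : ℕ → ExtInt) : ℝ :=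
  if SeqInterlace a b then
    ∏ j ∈ Finset.Icc 1 M, ∏ k ∈ Finset.Icc 1 j,
      if a j < b j ∧ b j = b k ∧ b k < a (k - 1) then 1 - t ^ (j - k + 1) else 1
  else 0

/-- `ψ_{μ/λ}` for signatures. -/
noncomputable def psi (t : ℝ) {M N : ℕ} (mu : Sig M) (lam : Sig N) : ℝ :=
  psiSeq t M mu.ext lam.ext

/-- `φ_{μ/λ}` for signatures. -/
noncomputable def phi (t : ℝ) {M N : ℕ} (mu : Sig M) (lam : Sig N) : ℝ :=
  phiSeq t M mu.ext lam.ext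

/-- `ψ_{μ/λ}` for Young diagrams; `μ.colLen 0` is the number of rows of `μ`. -/
noncomputable def psiYoung (t : ℝ) (mu lam : YoungDiagram) : ℝ :=
  psiSeq t (mu.colLen 0) (youngExt mu) (youngExt lam)

/-- `φ_{μ/λ}` for Young diagrams. -/
noncomputable def phiYoung (t : ℝ) (mu lam : YoungDiagram) : ℝ :=
  phiSeq t (mu.colLen 0) (youngExt mu) (youngExt lam)

/-- Signatures `Λ (i, j)` at the vertices of a grid, with integer labels `h i j` on the horizontal
edges `(i, j) – (i + 1, j)` and `v i j` on the vertical edges `(i, j) – (i, j + 1)`. -/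
structure Grid (N : ℕ) where
  val : ℕ → ℕ → Sig N
  h : ℕ → ℕ → ℤ
  v : ℕ → ℕ → ℤ

/-- `G`, restricted to the rectangle `[0, m] × [0, n]`, is an admissible function on all vertices
of the rectangle, with values `λ, ν, μ, ρ` at the corners `(0,0), (m,0), (0,n), (m,n)`.
Values of `G` outside the rectangle are irrelevant. -/
structure IsAdmissible {N : ℕ} (m n : ℕ) (mu rho lam nu : Sig N) (G : Grid N) : Prop where
  sw : G.val 0 0 = lam
  se : G.val m 0 = nu
  nw : G.val 0 n = mu
  ne : G.val m n = rho
  move_h : ∀ i j, i < m → j ≤ n → (G.val i j).Moves (G.val (i + 1) j) (G.h i j)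
  move_v : ∀ i j, i ≤ m → j < n → (G.val i j).Moves (G.val i (j + 1)) (G.v i j)
  h_lt : ∀ i j, i + 2 ≤ m → j ≤ n → G.h i j < G.h (i + 1) j
  v_lt : ∀ i j, i ≤ m → j + 2 ≤ n → G.v i j < G.v i (j + 1)
  box : ∀ i j, i < m → j < n → G.h i j = G.v i j →
    G.h i (j + 1) = G.v (i + 1) j ∧
      (G.h i (j + 1) = G.h i j ∨ G.h i (j + 1) = G.h i j + 1)

namespace Grid

variable {N : ℕ} (G : Grid N)

/-- The box with south-western corner `(i, j)` is a zero-box. -/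
def IsZero (i j : ℕ) : Prop :=
  G.h i j = G.v i j ∧ G.h i (j + 1) = G.h i j ∧ G.v (i + 1) j = G.h i j

/-- The box with south-western corner `(i, j)` is a one-box. -/
def IsOne (i j : ℕ) : Prop :=
  G.h i j = G.v i j ∧ G.h i (j + 1) = G.h i j + 1 ∧ G.v (i + 1) j = G.h i j + 1

/-- The box with south-western corner `(i, j)` is a trivial box. -/
def IsTrivial (i j : ℕ) : Prop :=
  G.h i j = G.h i (j + 1) ∧ G.h i j ≠ G.v i j ∧ G.v i j = G.v (i + 1) j

/-- The number `r(B)` of the box `B = b_{i,j}`. -/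
def r (i j : ℕ) : ℤ := G.h i j

/-- The number `r̄(B)` of the box `B = b_{i,j}`. -/
def rBar (i j : ℕ) : ℤ := G.h i (j + 1)

/-- `h_{i-1,j}`, which is `-∞` for `i = 0`. -/
def hPrev (i j : ℕ) : WithBot ℤ := if i = 0 then ⊥ else (G.h (i - 1) j : WithBot ℤ)

/-- `v_{i,j-1}`, which is `-∞` for `j = 0`. -/
def vPrev (i j : ℕ) : WithBot ℤ := if j = 0 then ⊥ else (G.v i (j - 1) : WithBot ℤ)

/-- `c(B) = t ^ (number of coordinates of Λ(i, j) equal to r(B))`. -/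
noncomputable def c (t : ℝ) (i j : ℕ) : ℝ := t ^ (G.val i j).count (G.r i j)

open Classical in
/-- The weight `w(B)` of the box `B = b_{i,j}`. Boxes outside of the rectangle are trivial.
In the last line, `B` is a one-box (resp. a zero-box), while `b_{i-1,j-1}` is a zero-box
(resp. a one-box) with `r̄(b_{i-1,j-1}) = r(B) - 1`. -/
noncomputable def weight (t : ℝ) (i j : ℕ) : ℝ :=
  if G.IsTrivial i j then 1
  else if G.IsOne i j ∧ ((1 ≤ i ∧ G.IsOne (i - 1) j) ∨ (1 ≤ j ∧ G.IsOne i (j - 1))) then 1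
  else if G.IsOne i j ∧ 1 ≤ i ∧ 1 ≤ j ∧ G.IsOne (i - 1) (j - 1) ∧
      G.rBar (i - 1) (j - 1) = G.r i j - 1 then 1
  else if G.IsZero i j ∧ 1 ≤ i ∧ 1 ≤ j ∧ G.IsZero (i - 1) (j - 1) ∧
      G.rBar (i - 1) (j - 1) = G.r i j - 1 then 1
  else if G.IsZero i j ∧ Xor (G.hPrev i j = ((G.r i j - 1 : ℤ) : WithBot ℤ))
      (G.vPrev i j = ((G.r i j - 1 : ℤ) : WithBot ℤ)) then t
  else if G.IsOne i j ∧ (i = 0 ∨ G.IsTrivial (i - 1) j) ∧ (j = 0 ∨ G.IsTrivial i (j - 1)) ∧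
      Xor (G.hPrev i j = ((G.r i j - 1 : ℤ) : WithBot ℤ))
        (G.vPrev i j = ((G.r i j - 1 : ℤ) : WithBot ℤ)) then 1 - t
  else if G.IsZero i j ∧ G.hPrev i j < ((G.r i j - 1 : ℤ) : WithBot ℤ) ∧
      G.vPrev i j < ((G.r i j - 1 : ℤ) : WithBot ℤ) then (t - G.c t i j) / (1 - G.c t i j)
  else if G.IsOne i j ∧ G.hPrev i j < ((G.r i j - 1 : ℤ) : WithBot ℤ) ∧
      G.vPrev i j < ((G.r i j - 1 : ℤ) : WithBot ℤ) then (1 - t) / (1 - G.c t i j)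
  else 0

end Grid

open Classical in
/-- The transition weight `U(μ → ρ ∣ λ → ν)`: the product of the weights of all boxes of the
rectangle `[0, m] × [0, n]`, `m = |ν| - |λ|`, `n = |μ| - |λ|`, for the (unique) admissible function
with the given values at the corners; zero if there is none, or if the interlacing conditions or
`|ν| - |λ| = |ρ| - |μ|` fail. -/
noncomputable def U (t : ℝ) {N : ℕ} (mu rho lam nu : Sig N) : ℝ :=
  if h : (Interlace lam nu ∧ Interlace lam mu ∧ Interlace nu rho ∧ Interlace mu rho ∧
      nu.size - lam.size = rho.size - mu.size) ∧
      ∃ G : Grid N, IsAdmissible (nu.size - lam.size).toNat (mu.size - lam.size).toNat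
        mu rho lam nu G then
    ∏ i ∈ Finset.range (nu.size - lam.size).toNat,
      ∏ j ∈ Finset.range (mu.size - lam.size).toNat, h.2.choose.weight t i j
  else 0

/-- The conditions under which the weights with input `r` are defined by adding to `λ` and `ν`
the last coordinates `a - r` and `a`: interlacing, `|ρ| - |μ| = |ν| - |λ| + r`, and `a` is strictly
smaller than all coordinates of `μ` and `ν`. -/
structure InputCond {N : ℕ} (r : ℕ) (a : ℤ) (mu rho : Sig (N + 1)) (lam nu : Sig N) : Prop where
  lam_mu : Interlace lam mu
  lam_nu : Interlace lam nu
  mu_rho : Interlace mu rho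
  nu_rho : Interlace nu rho
  size_eq : rho.size - mu.size = nu.size - lam.size + r
  lt_mu : ∀ i, a < mu.part i
  lt_nu : ∀ i, a < nu.part i

theorem InputCond.le_nu {N : ℕ} {r : ℕ} {a : ℤ} {mu rho : Sig (N + 1)} {lam nu : Sig N}
    (h : InputCond r a mu rho lam nu) (i : Fin N) : a ≤ nu.part i := (h.lt_nu i).le

theorem InputCond.le_lam {N : ℕ} {r : ℕ} {a : ℤ} {mu rho : Sig (N + 1)} {lam nu : Sig N}
    (h : InputCond r a mu rho lam nu) (i : Fin N) : a - r ≤ lam.part i := by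
  have h1 := (h.lam_mu (i + 1) (by omega)).2
  simp [Sig.ext, i.isLt] at h1
  have h2 : mu.part i.succ ≤ lam.part i := h1
  have h3 := h.lt_mu i.succ
  omega

open Classical in
/-- The weight `U^r(μ → ρ ∣ λ → ν)` with input `r`, for `λ, ν` of length `N` and `μ, ρ` of length
`N + 1`: the weight `U(μ → ρ ∣ λ̃ → ν̃)` with `λ̃ = (λ_1, …, λ_N, a - r)` and
`ν̃ = (ν_1, …, ν_N, a)`. -/
noncomputable def UInput (t : ℝ) {N : ℕ} (r : ℕ) (a : ℤ) (mu rho : Sig (N + 1))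
    (lam nu : Sig N) : ℝ :=
  if h : InputCond r a mu rho lam nu then
    U t mu rho (lam.append (a - r) h.le_lam) (nu.append a h.le_nu)
  else 0

open Classical in
/-- The weight `Û^r(ν → λ ∣ ρ → μ)`, defined as `U(-ν̃ → -λ̃ ∣ -ρ → -μ)` with the same `λ̃`, `ν̃`. -/
noncomputable def UHatInput (t : ℝ) {N : ℕ} (r : ℕ) (a : ℤ) (nu lam : Sig N)
    (rho mu : Sig (N + 1)) : ℝ :=
  if h : InputCond r a mu rho lam nu then
    U t (nu.append a h.le_nu).neg (lam.append (a - r) h.le_lam).neg rho.neg mu.neg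
  else 0

end HLRSK

/-!
The proof compares the weights of an admissible function `Λ` and of its image under the rotation
`(i, j) ↦ -Λ(m - i, n - j)` box by box.

An admissible function is determined by its corners (`IsAdmissible.labels_unique`), so `U` can be
computed with any admissible function (`U_eq_prod`), and the rotation carries one for
`(λ, μ, ν, ρ)` to one for `(-ρ, -ν, -μ, -λ)` (`IsAdmissible.flip`). Every box is trivial, a zero-box
or a one-box, and its weight depends only on which of the labels meeting in its south-western corner
are consecutive integers, on the types of the boxes around this corner, and on a multiplicity
(`IsAdmissible.weight_eq_swWeight`). The weight of the rotated box is the same expression at the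
north-eastern corner (`Grid.flip_swWeight`).

The functions `φ` and `ψ` are products of factors `1 - t ^ k`, where `k` runs through the
multiplicities that grow by one, respectively drop by one (`phi_eq_prod`, `psi_eq_prod`). Along a
row or a column of `Λ` they become products over the edges (`IsPath.phi_eq`, `IsPath.psi_eq`). These
edge factors extend to the interior edges of the rectangle, with corrections at zero-boxes and
one-boxes, and together with factors on the vertices that join two nontrivial boxes diagonally they
turn the flip property into an identity for a single box (`IsAdmissible.local_flip`). In the product
over all boxes the factors in the interior cancel and those on the boundary are `φ` and `ψ`
(`prod_rectangle_of_local`, `IsAdmissible.prod_swWeight_mul`).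

Two points need care. If a vertex joins a zero-box and a one-box diagonally, the local identity
fails, but both products vanish. And the factor `t` of the zero-boxes may be zero, which would
forbid the cancellation; it is therefore replaced by an independent variable `s`, and `s = 0` is
reached by continuity.

For Young diagrams the additional part contributes `1 - t` to both `ψ_{μ/λ}` and `ψ_{ρ/ν}`
(`psi_append`), and it contributes `1 - t` to `φ_{ν/λ}` exactly if it moves, that is, if `r ≥ 1`
(`phi_append`).
-/

namespace HLRSK

/-! ### Signatures through the number of parts above a level -/

namespace Sig

variable {N : ℕ}

/-- The number of parts of `λ` larger than `x`. -/
def above (lam : Sig N) (x : ℤ) : ℕ := (Finset.univ.filter fun i => x < lam.part i).card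

theorem lt_part_iff (lam : Sig N) (x : ℤ) (i : Fin N) : x < lam.part i ↔ (i : ℕ) < lam.above x := by
  constructor
  · intro h
    have : Finset.Iic i ⊆ Finset.univ.filter fun i => x < lam.part i := by
      intro k hk
      simp only [Finset.mem_Iic] at hk
      simpa using h.trans_le (lam.anti hk)
    have := Finset.card_le_card this
    rw [Fin.card_Iic] at this
    exact this
  · intro h
    by_contra hx
    have : (Finset.univ.filter fun i => x < lam.part i) ⊆ Finset.Iio i := by
      intro k hk
      simp only [Finset.mem_filter, Finset.mem_univ, true_and] at hk
      simp only [Finset.mem_Iio]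
      by_contra hik
      exact hx (hk.trans_le (lam.anti (not_lt.mp hik)))
    have := Finset.card_le_card this
    rw [Fin.card_Iio] at this
    exact absurd h (not_lt.mpr this)

theorem above_le (lam : Sig N) (x : ℤ) : lam.above x ≤ N :=
  (Finset.card_le_univ _).trans (by simp)

theorem count_add_above (lam : Sig N) (x : ℤ) : lam.count x + lam.above x = lam.above (x - 1) := by
  unfold count above
  rw [← Finset.card_union_of_disjoint]
  · congr 1
    ext i
    simp only [Finset.mem_union, Finset.mem_filter, Finset.mem_univ, true_and]
    omega
  · rw [Finset.disjoint_filter]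
    intro i _ h
    omega

theorem Moves.above {lam lam' : Sig N} {a : ℤ} (h : lam.Moves lam' a) (x : ℤ) :
    lam'.above x = lam.above x + if x = a then 1 else 0 := by
  obtain ⟨i, hi, h⟩ := h
  unfold Sig.above
  split_ifs with hx
  · have : (Finset.univ.filter fun k => x < lam'.part k) =
        insert i (Finset.univ.filter fun k => x < lam.part k) := by
      ext k
      rcases eq_or_ne k i with rfl | hk
      · simp [h, hx]
      · simp [h, hk]
    rw [this, Finset.card_insert_of_notMem]
    simp [hi, hx]
  · rw [add_zero]
    congr 1
    ext k
    rcases eq_or_ne k i with rfl | hk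
    · simp only [h, Function.update_self, Finset.mem_filter, Finset.mem_univ, true_and, hi]
      omega
    · simp [h, hk]

theorem Moves.count_pos {lam lam' : Sig N} {a : ℤ} (h : lam.Moves lam' a) : 1 ≤ lam.count a := by
  obtain ⟨i, hi, -⟩ := h
  exact Finset.card_pos.mpr ⟨i, by simpa using hi⟩

theorem Moves.count {lam lam' : Sig N} {a : ℤ} (h : lam.Moves lam' a) (x : ℤ) :
    lam'.count x + (if x = a then 1 else 0) = lam.count x + if x = a + 1 then 1 else 0 := by
  have h1 := lam.count_add_above x
  have h2 := lam'.count_add_above x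
  rw [h.above, h.above] at h2
  split_ifs at h2 ⊢ <;> omega

theorem count_neg (lam : Sig N) (x : ℤ) : lam.neg.count x = lam.count (-x) := by
  unfold count
  refine Finset.card_bij (fun i _ => i.rev) (fun i hi => ?_)
    (fun i _ k _ h => Fin.rev_injective h) (fun i hi => ⟨i.rev, ?_, Fin.rev_rev i⟩)
  · simpa [neg, neg_eq_iff_eq_neg] using hi
  · simpa [neg, neg_eq_iff_eq_neg] using hi

theorem size_neg (lam : Sig N) : lam.neg.size = -lam.size := by
  unfold size neg
  simp only [Finset.sum_neg_distrib, neg_inj]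
  exact Equiv.sum_comp Fin.revPerm lam.part

@[simp] theorem neg_neg (lam : Sig N) : lam.neg.neg = lam := by
  cases lam
  simp [neg]

theorem Moves.neg {lam lam' : Sig N} {a : ℤ} (h : lam.Moves lam' a) :
    lam'.neg.Moves lam.neg (-a - 1) := by
  obtain ⟨i, hi, h⟩ := h
  refine ⟨i.rev, ?_, ?_⟩
  · simp only [Sig.neg, Fin.rev_rev, h, Function.update_self]
    ring
  · ext k
    rcases eq_or_ne k i.rev with rfl | hk
    · simp [Sig.neg, hi]
    · have : k.rev ≠ i := fun h => hk (by rw [← h, Fin.rev_rev])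
      simp [Sig.neg, h, hk, this]

theorem ext_zero (lam : Sig N) : lam.ext 0 = ⊤ := rfl

theorem ext_succ (lam : Sig N) (k : Fin N) : lam.ext (k + 1) = ((lam.part k : ℤ) : WithTop ℤ) := by
  simp [ext]

theorem ext_of_lt (lam : Sig N) {k : ℕ} (hk : N < k) : lam.ext k = ⊥ := by
  have h1 : k ≠ 0 := by omega
  have h2 : ¬ k - 1 < N := by omega
  simp [ext, h1, h2]

theorem exists_fin {N k : ℕ} (hk : 1 ≤ k) (hN : k ≤ N) : ∃ i : Fin N, k = i + 1 :=
  ⟨⟨k - 1, by omega⟩, by simp; omega⟩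

theorem coe_lt_coe_ext (x y : ℤ) :
    (((x : ℤ) : WithTop ℤ) : ExtInt) < ((y : ℤ) : WithTop ℤ) ↔ x < y := by
  rw [WithBot.coe_lt_coe, WithTop.coe_lt_coe]

theorem coe_eq_coe_ext (x y : ℤ) :
    (((x : ℤ) : WithTop ℤ) : ExtInt) = ((y : ℤ) : WithTop ℤ) ↔ x = y := by
  rw [WithBot.coe_inj, WithTop.coe_inj]

theorem coe_le_coe_ext (x y : ℤ) :
    (((x : ℤ) : WithTop ℤ) : ExtInt) ≤ ((y : ℤ) : WithTop ℤ) ↔ x ≤ y := by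
  rw [WithBot.coe_le_coe, WithTop.coe_le_coe]

theorem lt_ext_iff (lam : Sig N) (x : ℤ) {k : ℕ} (hk : 1 ≤ k) :
    (((x : ℤ) : WithTop ℤ) : ExtInt) < lam.ext k ↔ k ≤ lam.above x := by
  by_cases hN : k ≤ N
  · obtain ⟨i, rfl⟩ := exists_fin hk hN
    rw [ext_succ, coe_lt_coe_ext, lt_part_iff]
    rfl
  · rw [ext_of_lt _ (by omega)]
    have := lam.above_le x
    simp
    omega

theorem ext_lt_iff (lam : Sig N) (x : ℤ) {k : ℕ} (hk : 1 ≤ k) :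
    lam.ext k < (((x : ℤ) : WithTop ℤ) : ExtInt) ↔ lam.above (x - 1) < k := by
  by_cases hN : k ≤ N
  · obtain ⟨i, rfl⟩ := exists_fin hk hN
    rw [ext_succ, coe_lt_coe_ext]
    have := lam.lt_part_iff (x - 1) i
    omega
  · rw [ext_of_lt _ (by omega)]
    have := lam.above_le (x - 1)
    simp only [WithBot.bot_lt_coe, true_iff]
    omega

theorem ext_eq_iff (lam : Sig N) (x : ℤ) {k : ℕ} (hk : 1 ≤ k) :
    lam.ext k = (((x : ℤ) : WithTop ℤ) : ExtInt) ↔ lam.above x < k ∧ k ≤ lam.above (x - 1) := by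
  have h1 := lam.lt_ext_iff x hk
  have h2 := lam.ext_lt_iff x hk
  rw [← not_iff_not, ← ne_eq, ne_iff_lt_or_gt, h2, h1]
  omega

end Sig

/-- Interlacing says that at every level the number of larger parts grows by zero or one. -/
theorem Interlace.above {N : ℕ} {lam mu : Sig N} (h : Interlace lam mu) (x : ℤ) :
    lam.above x ≤ mu.above x ∧ mu.above x ≤ lam.above x + 1 := by
  constructor
  · rcases Nat.eq_zero_or_pos (lam.above x) with h0 | h0
    · omega
    · exact (mu.lt_ext_iff x h0).mp (((lam.lt_ext_iff x h0).mpr le_rfl).trans_le (h _ h0).1)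
  · by_contra! hc
    have h0 : 1 ≤ lam.above x + 1 := by omega
    have h1 := ((mu.lt_ext_iff x (by omega)).mpr hc).trans_le (h _ h0).2
    have := (lam.lt_ext_iff x h0).mp h1
    omega

/-- `φ_{ν/λ}` as a product over the levels `x` whose multiplicity grows. -/
theorem phi_eq_prod {N : ℕ} (t : ℝ) {lam nu : Sig N} (h : Interlace lam nu) (S : Finset ℤ)
    (hS : ∀ x, x ∈ S ↔ nu.count x = lam.count x + 1) :
    phi t nu lam = ∏ x ∈ S, (1 - t ^ nu.count x) := by
  classical
  rw [phi, phiSeq, if_pos (show SeqInterlace _ _ from h), Finset.prod_sigma', ← Finset.prod_filter]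
  symm
  refine Finset.prod_bij (fun x _ => ⟨nu.above (x - 1), nu.above x + 1⟩) ?_ ?_ ?_ ?_
  · intro x hx
    rw [hS] at hx
    have h1 := nu.count_add_above x
    have h2 := lam.count_add_above x
    have h3 := h.above x
    have h4 := h.above (x - 1)
    have h5 := nu.above_le (x - 1)
    simp only [Finset.mem_filter, Finset.mem_sigma, Finset.mem_Icc, Nat.add_sub_cancel]
    rw [(nu.ext_eq_iff x (k := nu.above (x - 1)) (by omega)).mpr (by omega),
      (nu.ext_eq_iff x (k := nu.above x + 1) (by omega)).mpr (by omega),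
      lam.ext_lt_iff x (by omega)]
    refine ⟨by omega, by omega, rfl, ?_⟩
    rcases Nat.eq_zero_or_pos (nu.above x) with h0 | h0
    · rw [h0, Sig.ext_zero]
      exact WithBot.coe_lt_coe.mpr (WithTop.coe_lt_top _)
    · rw [lam.lt_ext_iff x h0]
      omega
  · intro x hx y hy hxy
    rw [hS] at hx hy
    have h1 := nu.count_add_above x
    have h2 := nu.count_add_above y
    simp only [Sigma.mk.injEq, heq_eq_eq, Nat.add_right_cancel_iff] at hxy
    have e1 := (nu.ext_eq_iff x (k := nu.above (x - 1)) (by omega)).mpr (by omega)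
    have e2 := (nu.ext_eq_iff y (k := nu.above (x - 1)) (by omega)).mpr (by omega)
    rw [e1, Sig.coe_eq_coe_ext] at e2
    exact e2
  · rintro ⟨j, k⟩ hjk
    simp only [Finset.mem_filter, Finset.mem_sigma, Finset.mem_Icc] at hjk
    obtain ⟨⟨⟨hj1, hjN⟩, hk1, hkj⟩, c1, c2, c3⟩ := hjk
    obtain ⟨i, rfl⟩ := Sig.exists_fin hj1 hjN
    set x := nu.part i
    rw [nu.ext_succ] at c1 c2
    rw [← c2] at c3
    rw [lam.ext_lt_iff x hj1] at c1
    have d2 := (nu.ext_eq_iff x hk1).mp c2.symm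
    have d1 := (nu.ext_eq_iff x hj1).mp (nu.ext_succ i)
    have d3 : k = 1 ∨ k - 1 ≤ lam.above x := by
      rcases Nat.lt_or_ge 1 k with hk | hk
      · right
        rwa [lam.lt_ext_iff x (by omega)] at c3
      · left
        omega
    have h1 := nu.count_add_above x
    have h2 := lam.count_add_above x
    have h3 := h.above x
    have h4 := h.above (x - 1)
    refine ⟨x, ?_, ?_⟩
    · rw [hS]
      omega
    · have e1 : nu.above (x - 1) = i + 1 := by omega
      have e2 : nu.above x + 1 = k := by omega
      simp only [e1, e2]
  · intro x hx
    rw [hS] at hx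
    have h1 := nu.count_add_above x
    dsimp only
    congr 2
    omega

/-- `ψ_{μ/λ}` as a product over the levels `x` whose multiplicity drops. -/
theorem psi_eq_prod {N : ℕ} (t : ℝ) {lam mu : Sig N} (h : Interlace lam mu) (S : Finset ℤ)
    (hS : ∀ x, x ∈ S ↔ lam.count x = mu.count x + 1) :
    psi t mu lam = ∏ x ∈ S, (1 - t ^ lam.count x) := by
  classical
  rw [psi, psiSeq, if_pos (show SeqInterlace _ _ from h), Finset.prod_sigma', ← Finset.prod_filter]
  symm
  refine Finset.prod_bij (fun x _ => ⟨lam.above (x - 1), lam.above x + 1⟩) ?_ ?_ ?_ ?_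
  · intro x hx
    rw [hS] at hx
    have h1 := mu.count_add_above x
    have h2 := lam.count_add_above x
    have h3 := h.above x
    have h4 := h.above (x - 1)
    have h5 := lam.above_le (x - 1)
    simp only [Finset.mem_filter, Finset.mem_sigma, Finset.mem_Icc]
    rw [(lam.ext_eq_iff x (k := lam.above (x - 1)) (by omega)).mpr (by omega),
      (lam.ext_eq_iff x (k := lam.above x + 1) (by omega)).mpr (by omega),
      mu.ext_lt_iff x (by omega), mu.lt_ext_iff x (by omega)]
    refine ⟨by omega, by omega, rfl, by omega⟩
  · intro x hx y hy hxy
    rw [hS] at hx hy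
    have h1 := lam.count_add_above x
    have h2 := lam.count_add_above y
    simp only [Sigma.mk.injEq, heq_eq_eq, Nat.add_right_cancel_iff] at hxy
    have e1 := (lam.ext_eq_iff x (k := lam.above (x - 1)) (by omega)).mpr (by omega)
    have e2 := (lam.ext_eq_iff y (k := lam.above (x - 1)) (by omega)).mpr (by omega)
    rw [e1, Sig.coe_eq_coe_ext] at e2
    exact e2
  · rintro ⟨j, k⟩ hjk
    simp only [Finset.mem_filter, Finset.mem_sigma, Finset.mem_Icc] at hjk
    obtain ⟨⟨⟨hj1, hjN⟩, hk1, hkj⟩, c1, c2, c3⟩ := hjk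
    obtain ⟨i, rfl⟩ := Sig.exists_fin hj1 hjN
    set x := lam.part i
    rw [Sig.ext_succ] at c1 c2
    rw [← c2] at c3
    rw [mu.ext_lt_iff x (by omega)] at c1
    rw [mu.lt_ext_iff x hk1] at c3
    have d2 := (lam.ext_eq_iff x hk1).mp c2.symm
    have d1 := (lam.ext_eq_iff x hj1).mp (lam.ext_succ i)
    have h1 := mu.count_add_above x
    have h2 := lam.count_add_above x
    have h3 := h.above x
    have h4 := h.above (x - 1)
    refine ⟨x, ?_, ?_⟩
    · rw [hS]
      omega
    · have e1 : lam.above (x - 1) = i + 1 := by omega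
      have e2 : lam.above x + 1 = k := by omega
      simp only [e1, e2]
  · intro x hx
    rw [hS] at hx
    have h1 := lam.count_add_above x
    dsimp only
    congr 2
    omega

theorem one_sub_pow_ne_zero {t : ℝ} (ht0 : 0 ≤ t) (ht1 : t < 1) {k : ℕ} (hk : 1 ≤ k) :
    1 - t ^ k ≠ 0 :=
  (sub_pos.mpr (pow_lt_one₀ ht0 ht1 (by omega))).ne'

theorem phi_ne_zero {t : ℝ} (ht0 : 0 ≤ t) (ht1 : t < 1) {M N : ℕ} {mu : Sig M} {lam : Sig N}
    (h : Interlace lam mu) : phi t mu lam ≠ 0 := by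
  classical
  rw [phi, phiSeq, if_pos (show SeqInterlace _ _ from h)]
  refine Finset.prod_ne_zero_iff.mpr fun j _ => Finset.prod_ne_zero_iff.mpr fun k _ => ?_
  split_ifs
  · exact one_sub_pow_ne_zero ht0 ht1 (by omega)
  · exact one_ne_zero

theorem psi_ne_zero {t : ℝ} (ht0 : 0 ≤ t) (ht1 : t < 1) {M N : ℕ} {mu : Sig M} {lam : Sig N}
    (h : Interlace lam mu) : psi t mu lam ≠ 0 := by
  classical
  rw [psi, psiSeq, if_pos (show SeqInterlace _ _ from h)]
  refine Finset.prod_ne_zero_iff.mpr fun j _ => Finset.prod_ne_zero_iff.mpr fun k _ => ?_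
  split_ifs
  · exact one_sub_pow_ne_zero ht0 ht1 (by omega)
  · exact one_ne_zero

theorem interlace_iff_part {N : ℕ} {lam mu : Sig N} : Interlace lam mu ↔
    (∀ i, lam.part i ≤ mu.part i) ∧ ∀ i k : Fin N, (i : ℕ) + 1 = k → mu.part k ≤ lam.part i := by
  constructor
  · intro h
    refine ⟨fun i => ?_, fun i k hik => ?_⟩
    · have := (h (i + 1) (by omega)).1
      rwa [Sig.ext_succ, Sig.ext_succ, Sig.coe_le_coe_ext] at this
    · have := (h (i + 1) (by omega)).2
      rwa [Sig.ext_succ, hik, Sig.ext_succ, Sig.coe_le_coe_ext] at this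
  · rintro ⟨h1, h2⟩ k hk
    by_cases hN : k ≤ N
    · obtain ⟨i, rfl⟩ := Sig.exists_fin hk hN
      refine ⟨?_, ?_⟩
      · rw [Sig.ext_succ, Sig.ext_succ, Sig.coe_le_coe_ext]
        exact h1 i
      · by_cases hN' : (i : ℕ) + 1 < N
        · have := mu.ext_succ ⟨i + 1, hN'⟩
          rw [this, Sig.ext_succ, Sig.coe_le_coe_ext]
          exact h2 _ _ rfl
        · rw [Sig.ext_of_lt mu (by omega)]
          exact bot_le
    · rw [Sig.ext_of_lt lam (by omega), Sig.ext_of_lt mu (by omega), Sig.ext_of_lt mu (by omega)]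
      exact ⟨le_rfl, le_rfl⟩

theorem Interlace.neg {N : ℕ} {lam mu : Sig N} (h : Interlace lam mu) :
    Interlace mu.neg lam.neg := by
  rw [interlace_iff_part] at h ⊢
  refine ⟨fun i => neg_le_neg (h.1 _), fun i k hik => neg_le_neg (h.2 _ _ ?_)⟩
  rw [Fin.val_rev, Fin.val_rev]
  omega

/-! ### Local structure of admissible functions -/

namespace Grid

variable {N : ℕ} (G : Grid N)

/-- At the vertex `(i, j)` the horizontal edge on the left and the one on the right exist, and
their labels are consecutive integers. -/
def HConsec (m i j : ℕ) : Prop := 1 ≤ i ∧ i < m ∧ G.h (i - 1) j + 1 = G.h i j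

/-- At the vertex `(i, j)` the vertical edge below and the one above exist, and their labels are
consecutive integers. -/
def VConsec (n i j : ℕ) : Prop := 1 ≤ j ∧ j < n ∧ G.v i (j - 1) + 1 = G.v i j

/-- The boxes to the south-west and to the north-east of the vertex `(i, j)` are both nontrivial,
and `r̄ + 1` of the first equals `r` of the second. -/
def Linked (m n i j : ℕ) : Prop := G.HConsec m i j ∧ G.VConsec n i j ∧ G.h i j = G.v i j

/-- The left neighbour of the box `b_{i,j}` is a one-box. -/
def LeftOne (i j : ℕ) : Prop := 1 ≤ i ∧ G.IsOne (i - 1) j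

/-- The lower neighbour of the box `b_{i,j}` is a one-box. -/
def BelowOne (i j : ℕ) : Prop := 1 ≤ j ∧ G.IsOne i (j - 1)

/-- The right neighbour of the box `b_{i,j}` is a one-box. -/
def RightOne (m i j : ℕ) : Prop := i + 1 < m ∧ G.IsOne (i + 1) j

/-- The upper neighbour of the box `b_{i,j}` is a one-box. -/
def AboveOne (n i j : ℕ) : Prop := j + 1 < n ∧ G.IsOne i (j + 1)

theorem hConsec_of_leftOne {m i j : ℕ} (hi : i < m) (h : G.h i j = G.v i j)
    (hl : G.LeftOne i j) : G.HConsec m i j := by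
  unfold LeftOne IsOne HConsec at *
  obtain _ | i := i
  · simp at hl
  · simp only [Nat.add_sub_cancel] at *
    omega

theorem vConsec_of_belowOne {n i j : ℕ} (hj : j < n) (h : G.h i j = G.v i j)
    (hl : G.BelowOne i j) : G.VConsec n i j := by
  unfold BelowOne IsOne VConsec at *
  obtain _ | j := j
  · simp at hl
  · simp only [Nat.add_sub_cancel] at *
    omega

theorem hConsec_of_rightOne {m i j : ℕ} (h : G.h i (j + 1) = G.v (i + 1) j)
    (hl : G.RightOne m i j) : G.HConsec m (i + 1) (j + 1) := by
  unfold RightOne IsOne HConsec at *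
  simp only [Nat.add_sub_cancel] at *
  omega

theorem vConsec_of_aboveOne {n i j : ℕ} (h : G.h i (j + 1) = G.v (i + 1) j)
    (hl : G.AboveOne n i j) : G.VConsec n (i + 1) (j + 1) := by
  unfold AboveOne IsOne VConsec at *
  simp only [Nat.add_sub_cancel] at *
  omega

end Grid

namespace IsAdmissible

variable {N m n : ℕ} {mu rho lam nu : Sig N} {G : Grid N}

/-- Every box of an admissible function is trivial, a zero-box or a one-box: both ways around the box
lead from `Λ(i, j)` to `Λ(i + 1, j + 1)`, so the labels on them agree as multisets. -/
theorem box_trichotomy (hG : IsAdmissible m n mu rho lam nu G) {i j : ℕ} (hi : i < m) (hj : j < n) :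
    (G.h i j = G.h i (j + 1) ∧ G.h i j ≠ G.v i j ∧ G.v i j = G.v (i + 1) j) ∨
    (G.h i j = G.v i j ∧ G.h i (j + 1) = G.h i j ∧ G.v (i + 1) j = G.h i j) ∨
    (G.h i j = G.v i j ∧ G.h i (j + 1) = G.h i j + 1 ∧ G.v (i + 1) j = G.h i j + 1) := by
  have key : ∀ x, ((if x = G.h i j then 1 else 0) + if x = G.v (i + 1) j then 1 else 0 : ℕ) =
      (if x = G.v i j then 1 else 0) + if x = G.h i (j + 1) then 1 else 0 := by
    intro x
    have h1 := (hG.move_h i j hi hj.le).above x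
    have h2 := (hG.move_v (i + 1) j hi hj).above x
    have h3 := (hG.move_v i j hi.le hj).above x
    have h4 := (hG.move_h i (j + 1) hi hj).above x
    omega
  by_cases h : G.h i j = G.v i j
  · have := hG.box i j hi hj h
    omega
  · left
    have h1 := key (G.h i j)
    have h2 := key (G.v i j)
    simp only [if_true, h, Ne.symm h, if_false] at h1 h2
    split_ifs at h1 h2 <;> omega

theorem h_lt' (hG : IsAdmissible m n mu rho lam nu G)
    {i j : ℕ} (hi : i + 1 < m) (hj : j ≤ n) : G.h i j < G.h (i + 1) j :=
  hG.h_lt i j hi hj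

theorem v_lt' (hG : IsAdmissible m n mu rho lam nu G)
    {i j : ℕ} (hi : i ≤ m) (hj : j + 1 < n) : G.v i j < G.v i (j + 1) :=
  hG.v_lt i j hi hj

/-- The vertical label below a zero-box is the same on both sides, as the box below it is trivial. -/
theorem vConsec_right_of_isZero (hG : IsAdmissible m n mu rho lam nu G)
    {i j : ℕ} (hi : i < m) (hj : j < n) (h : G.IsZero i j) :
    G.VConsec n (i + 1) j ↔ G.VConsec n i j := by
  unfold Grid.VConsec Grid.IsZero at *
  obtain _ | j := j
  · simp
  · have := hG.box_trichotomy (i := i) (j := j) hi (by omega)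
    have := hG.v_lt' (i := i + 1) (j := j) (by omega) (by omega)
    simp only [Nat.add_sub_cancel]
    omega

/-- The horizontal label to the right of a zero-box is the same at the bottom and at the top, as the
box to the right of it is trivial. -/
theorem hConsec_right_of_isZero (hG : IsAdmissible m n mu rho lam nu G)
    {i j : ℕ} (hi : i < m) (hj : j < n) (h : G.IsZero i j) :
    G.HConsec m (i + 1) (j + 1) ↔ G.HConsec m (i + 1) j := by
  unfold Grid.HConsec Grid.IsZero at *
  simp only [Nat.add_sub_cancel]
  by_cases hi' : i + 1 < m
  · have := hG.box_trichotomy (i := i + 1) (j := j) hi' hj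
    have := hG.h_lt' (i := i) (j := j) (by omega) (by omega)
    have := hG.h_lt' (i := i) (j := j + 1) (by omega) (by omega)
    omega
  · omega

/-- To the right of a zero-box there is no nontrivial box. -/
theorem not_isZero_left (hG : IsAdmissible m n mu rho lam nu G)
    {i j : ℕ} (hi : i + 1 < m) (hj : j < n)
    (h : G.h (i + 1) j = G.v (i + 1) j) : ¬ G.IsZero i j := by
  unfold Grid.IsZero
  have := hG.h_lt' (i := i) (j := j) hi (by omega)
  omega

/-- Above a zero-box there is no nontrivial box. -/
theorem not_isZero_below (hG : IsAdmissible m n mu rho lam nu G)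
    {i j : ℕ} (hi : i < m) (hj : j + 1 < n)
    (h : G.h i (j + 1) = G.v i (j + 1)) : ¬ G.IsZero i j := by
  unfold Grid.IsZero
  have := hG.v_lt' (i := i) (j := j) (by omega) hj
  omega

theorem not_isZero_right (hG : IsAdmissible m n mu rho lam nu G)
    {i j : ℕ} (hi : i + 1 < m) (hj : j < n) (h : G.IsOne i j) :
    ¬ G.IsZero (i + 1) j := by
  unfold Grid.IsZero Grid.IsOne at *
  have := hG.h_lt' (i := i) (j := j + 1) hi (by omega)
  omega

/-- For a trivial box with `v = h + 1`, consecutive vertical labels at the south-western corner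
come from a zero-box below. -/
theorem vConsec_iff_of_trivial (hG : IsAdmissible m n mu rho lam nu G)
    {i j : ℕ} (hi : i < m) (hj : j < n) (h : G.IsTrivial i j)
    (hv : G.v i j = G.h i j + 1) :
    G.VConsec n i j ↔ (1 ≤ j ∧ G.IsZero i (j - 1)) ∧ G.VConsec n (i + 1) j := by
  unfold Grid.IsTrivial Grid.IsZero Grid.VConsec at *
  obtain _ | j := j
  · simp
  · have := hG.box_trichotomy (i := i) (j := j) hi (by omega)
    simp only [Nat.add_sub_cancel] at *
    omega

/-- For a trivial box with `v = h + 1`, consecutive horizontal labels at the north-eastern corner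
come from a zero-box on the right. -/
theorem hConsec_iff_of_trivial (hG : IsAdmissible m n mu rho lam nu G)
    {i j : ℕ} (hi : i < m) (hj : j < n) (h : G.IsTrivial i j)
    (hv : G.v i j = G.h i j + 1) :
    G.HConsec m (i + 1) (j + 1) ↔
      (i + 1 < m ∧ G.IsZero (i + 1) j) ∧ G.HConsec m (i + 1) j := by
  unfold Grid.IsTrivial Grid.IsZero Grid.HConsec at *
  simp only [Nat.add_sub_cancel] at *
  by_cases hi' : i + 1 < m
  · have := hG.box_trichotomy (i := i + 1) (j := j) hi' hj
    have := hG.h_lt' (i := i) (j := j) (by omega) (by omega)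
    omega
  · omega

theorem vConsec_right_of_trivial (hG : IsAdmissible m n mu rho lam nu G)
    {i j : ℕ} (hi : i < m) (hj : j < n) (h : G.IsTrivial i j)
    (hv : G.v i j ≠ G.h i j + 1) : G.VConsec n (i + 1) j ↔ G.VConsec n i j := by
  unfold Grid.IsTrivial Grid.VConsec at *
  obtain _ | j := j
  · simp
  · have := hG.box_trichotomy (i := i) (j := j) hi (by omega)
    simp only [Nat.add_sub_cancel] at *
    omega

theorem hConsec_top_of_trivial (hG : IsAdmissible m n mu rho lam nu G)
    {i j : ℕ} (hi : i < m) (hj : j < n) (h : G.IsTrivial i j)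
    (hv : G.v i j ≠ G.h i j + 1) : G.HConsec m (i + 1) (j + 1) ↔ G.HConsec m (i + 1) j := by
  unfold Grid.IsTrivial Grid.HConsec at *
  simp only [Nat.add_sub_cancel] at *
  by_cases hi' : i + 1 < m
  · have := hG.box_trichotomy (i := i + 1) (j := j) hi' hj
    have := hG.h_lt' (i := i) (j := j) (by omega) (by omega)
    omega
  · omega

/-- Two boxes meeting in a linked vertex are nontrivial. -/
theorem isZero_or_isOne_of_linked (hG : IsAdmissible m n mu rho lam nu G)
    {i j : ℕ} (hi : i + 1 < m) (hj : j + 1 < n)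
    (h : G.Linked m n (i + 1) (j + 1)) :
    (G.IsZero i j ∨ G.IsOne i j) ∧ (G.IsZero (i + 1) (j + 1) ∨ G.IsOne (i + 1) (j + 1)) := by
  unfold Grid.Linked Grid.HConsec Grid.VConsec Grid.IsZero Grid.IsOne at *
  simp only [Nat.add_sub_cancel] at *
  have := hG.box_trichotomy (i := i) (j := j) (by omega) (by omega)
  have := hG.box_trichotomy (i := i + 1) (j := j + 1) hi hj
  omega

/-- If the box to the north-east of a linked vertex has a one-box on its left, then the box to the
south-west of the vertex is a one-box. -/
theorem isOne_diag_of_leftOne (hG : IsAdmissible m n mu rho lam nu G)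
    {i j : ℕ} (hi : i + 1 < m) (hj : j + 1 < n)
    (h : G.Linked m n (i + 1) (j + 1)) (hl : G.IsOne i (j + 1)) : G.IsOne i j := by
  have h1 := (hG.isZero_or_isOne_of_linked hi hj h).1
  refine h1.resolve_left fun h0 => ?_
  exact hG.not_isZero_below (by omega) hj hl.1 h0

/-- If the box to the north-east of a linked vertex has a one-box below it, then the box to the
south-west of the vertex is a one-box. -/
theorem isOne_diag_of_belowOne (hG : IsAdmissible m n mu rho lam nu G)
    {i j : ℕ} (hi : i + 1 < m) (hj : j + 1 < n)
    (h : G.Linked m n (i + 1) (j + 1)) (hl : G.IsOne (i + 1) j) : G.IsOne i j := by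
  have h1 := (hG.isZero_or_isOne_of_linked hi hj h).1
  refine h1.resolve_left fun h0 => ?_
  exact hG.not_isZero_left hi (by omega) hl.1 h0

end IsAdmissible

/-! ### The local form of the flip property -/

namespace Grid

variable {N : ℕ} (G : Grid N)

/-- The multiplicity of `x` in `Λ(i, j)`. -/
def mult (i j : ℕ) (x : ℤ) : ℕ := (G.val i j).count x

open Classical in
/-- The weight of the box `b_{i,j}` in terms of its south-western corner, with the factor `t` of
the zero-boxes replaced by an independent variable `s`. -/
noncomputable def swWeight (s t : ℝ) (m n i j : ℕ) : ℝ :=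
  if G.IsZero i j then
    if G.HConsec m i j ∧ G.VConsec n i j then (if G.IsZero (i - 1) (j - 1) then 1 else 0)
    else s * if ¬ G.HConsec m i j ∧ ¬ G.VConsec n i j then
      (1 - t ^ (G.mult i j (G.h i j) - 1)) / (1 - t ^ G.mult i j (G.h i j)) else 1
  else if G.IsOne i j then
    if G.HConsec m i j ∧ G.VConsec n i j then (if G.IsOne (i - 1) (j - 1) then 1 else 0)
    else (if G.LeftOne i j ∨ G.BelowOne i j then 1 else 1 - t) *
      if ¬ G.HConsec m i j ∧ ¬ G.VConsec n i j then (1 - t ^ G.mult i j (G.h i j))⁻¹ else 1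
  else 1

open Classical in
/-- The image of `swWeight` under the rotation of the rectangle by `π` that goes along with
`λ ↦ -λ`: the weight of the box `b_{i,j}` in terms of its north-eastern corner. -/
noncomputable def neWeight (s t : ℝ) (m n i j : ℕ) : ℝ :=
  if G.IsZero i j then
    if G.HConsec m (i + 1) (j + 1) ∧ G.VConsec n (i + 1) (j + 1) then
      (if G.IsZero (i + 1) (j + 1) then 1 else 0)
    else s * if ¬ G.HConsec m (i + 1) (j + 1) ∧ ¬ G.VConsec n (i + 1) (j + 1) then
      (1 - t ^ (G.mult (i + 1) (j + 1) (G.h i (j + 1) + 1) - 1)) /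
        (1 - t ^ G.mult (i + 1) (j + 1) (G.h i (j + 1) + 1)) else 1
  else if G.IsOne i j then
    if G.HConsec m (i + 1) (j + 1) ∧ G.VConsec n (i + 1) (j + 1) then
      (if G.IsOne (i + 1) (j + 1) then 1 else 0)
    else (if G.RightOne m i j ∨ G.AboveOne n i j then 1 else 1 - t) *
      if ¬ G.HConsec m (i + 1) (j + 1) ∧ ¬ G.VConsec n (i + 1) (j + 1) then
        (1 - t ^ G.mult (i + 1) (j + 1) (G.h i (j + 1) + 1))⁻¹ else 1
  else 1

open Classical in
/-- The gauge factor of the horizontal edge from `(i, j)` to `(i + 1, j)`. In the bottom row and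
in the top row only the first factor survives, and it is the contribution of the edge to `φ`. -/
noncomputable def hGauge (t : ℝ) (m n i j : ℕ) : ℝ :=
  (if ¬ G.HConsec m (i + 1) j ∧ ¬ (G.VConsec n (i + 1) j ∧ G.v (i + 1) j = G.h i j + 1) then
    1 - t ^ G.mult (i + 1) j (G.h i j + 1) else 1) *
  (if (1 ≤ j ∧ G.IsZero i (j - 1)) ∧ G.VConsec n (i + 1) j then
    1 - t ^ G.mult i j (G.h i j + 1) else 1) *
  (if G.BelowOne i j ∧ j < n ∧ G.IsOne i j then 1 - t else 1)

open Classical in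
/-- The gauge factor of the vertical edge from `(i, j)` to `(i, j + 1)`. In the leftmost and in the
rightmost column only the first factor survives, and it is the contribution of the edge to `ψ`. -/
noncomputable def vGauge (t : ℝ) (m n i j : ℕ) : ℝ :=
  (if ¬ G.VConsec n i j ∧ ¬ (G.HConsec m i j ∧ G.h i j = G.v i j) then
    1 - t ^ G.mult i j (G.v i j) else 1) *
  (if (i < m ∧ G.IsZero i j) ∧ G.HConsec m i j then
    1 - t ^ G.mult i (j + 1) (G.v i j) else 1) *
  (if G.LeftOne i j ∧ i < m ∧ G.IsOne i j then 1 - t else 1)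

open Classical in
/-- The gauge factor of the vertex `(i, j)`. -/
noncomputable def vertexGauge (s t : ℝ) (m n i j : ℕ) : ℝ :=
  if G.Linked m n i j then
    if G.IsZero i j then s / (1 - t ^ (G.mult i j (G.h i j) - 1))
    else (1 - t) / ((if G.LeftOne i j then 1 - t else 1) * if G.BelowOne i j then 1 - t else 1)
  else 1

/-- Two boxes that meet in a linked vertex are of the same type. -/
def Unmixed (m n : ℕ) : Prop := ∀ i j, i + 1 < m → j + 1 < n → G.Linked m n (i + 1) (j + 1) →
  (G.IsOne i j ↔ G.IsOne (i + 1) (j + 1))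

variable {G}

theorem IsOne.not_isZero {i j : ℕ} (h : G.IsOne i j) : ¬ G.IsZero i j := by
  unfold IsOne IsZero at *
  omega

theorem IsZero.not_isOne {i j : ℕ} (h : G.IsZero i j) : ¬ G.IsOne i j :=
  fun h' => h'.not_isZero h

theorem IsTrivial.not_isZero {i j : ℕ} (h : G.IsTrivial i j) : ¬ G.IsZero i j :=
  fun h' => h.2.1 h'.1

theorem IsTrivial.not_isOne {i j : ℕ} (h : G.IsTrivial i j) : ¬ G.IsOne i j :=
  fun h' => h.2.1 h'.1

end Grid

namespace IsAdmissible

open Grid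

variable {N m n : ℕ} {mu rho lam nu : Sig N} {G : Grid N}

theorem isTrivial_or (hG : IsAdmissible m n mu rho lam nu G) {i j : ℕ} (hi : i < m) (hj : j < n) :
    G.IsTrivial i j ∨ G.IsZero i j ∨ G.IsOne i j := hG.box_trichotomy hi hj

theorem mult_h (hG : IsAdmissible m n mu rho lam nu G) {i j : ℕ} (hi : i < m) (hj : j ≤ n)
    (x : ℤ) : G.mult (i + 1) j x + (if x = G.h i j then 1 else 0) =
      G.mult i j x + if x = G.h i j + 1 then 1 else 0 :=
  (hG.move_h i j hi hj).count x

theorem mult_v (hG : IsAdmissible m n mu rho lam nu G) {i j : ℕ} (hi : i ≤ m) (hj : j < n)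
    (x : ℤ) : G.mult i (j + 1) x + (if x = G.v i j then 1 else 0) =
      G.mult i j x + if x = G.v i j + 1 then 1 else 0 :=
  (hG.move_v i j hi hj).count x

theorem mult_h_pos (hG : IsAdmissible m n mu rho lam nu G) {i j : ℕ} (hi : i < m) (hj : j ≤ n) :
    1 ≤ G.mult i j (G.h i j) := (hG.move_h i j hi hj).count_pos

theorem mult_v_pos (hG : IsAdmissible m n mu rho lam nu G) {i j : ℕ} (hi : i ≤ m) (hj : j < n) :
    1 ≤ G.mult i j (G.v i j) := (hG.move_v i j hi hj).count_pos

theorem mult_h_add_one_pos (hG : IsAdmissible m n mu rho lam nu G) {i j : ℕ} (hi : i < m)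
    (hj : j ≤ n) : 1 ≤ G.mult (i + 1) j (G.h i j + 1) := by
  have := hG.mult_h hi hj (G.h i j + 1)
  simp at this
  omega

/-- In the south-western corner of a zero-box there are at least two particles to be moved. -/
theorem mult_of_isZero (hG : IsAdmissible m n mu rho lam nu G) {i j : ℕ} (hi : i < m) (hj : j < n)
    (h : G.IsZero i j) :
    2 ≤ G.mult i j (G.h i j) ∧ G.mult i (j + 1) (G.h i j) = G.mult i j (G.h i j) - 1 ∧
      G.mult (i + 1) j (G.h i j) = G.mult i j (G.h i j) - 1 := by
  have h1 := hG.mult_h hi hj.le (G.h i j)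
  have h2 := hG.mult_v hi.le hj (G.h i j)
  have h3 := hG.mult_v_pos (i := i + 1) hi hj
  rw [h.2.2] at h3
  rw [← h.1] at h2
  simp at h1 h2
  omega

theorem mult_top_of_isZero (hG : IsAdmissible m n mu rho lam nu G) {i j : ℕ} (hi : i < m)
    (hj : j < n) (h : G.IsZero i j) :
    2 ≤ G.mult (i + 1) (j + 1) (G.h i j + 1) ∧
      G.mult i (j + 1) (G.h i j + 1) = G.mult (i + 1) (j + 1) (G.h i j + 1) - 1 ∧
      G.mult (i + 1) j (G.h i j + 1) = G.mult (i + 1) (j + 1) (G.h i j + 1) - 1 := by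
  have h1 := hG.mult_h hi (j := j + 1) hj (G.h i j + 1)
  have h2 := hG.mult_v (i := i + 1) hi hj (G.h i j + 1)
  have h3 := hG.mult_h_add_one_pos hi hj.le
  rw [h.2.1] at h1
  rw [h.2.2] at h2
  simp at h1 h2
  omega

section Gauge

open scoped Classical

variable {s t : ℝ}

/-- The vertex gauge is chosen such that the weight of a one-box no longer depends on whether its
south-western corner is linked; the factors `1 - t` for adjacent one-boxes belong to the edges. -/
theorem _root_.HLRSK.Grid.Unmixed.swWeight_mul_of_isOne (hU : G.Unmixed m n)
    (ht1 : t < 1) {i j : ℕ} (hi : i < m) (hj : j < n) (h : G.IsOne i j) :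
    G.swWeight s t m n i j * G.vertexGauge s t m n i j *
      ((if G.LeftOne i j then 1 - t else 1) * if G.BelowOne i j then 1 - t else 1) =
    (1 - t) * if ¬ G.HConsec m i j ∧ ¬ G.VConsec n i j then
      (1 - t ^ G.mult i j (G.h i j))⁻¹ else 1 := by
  have hτ : 1 - t ≠ 0 := by linarith
  unfold swWeight vertexGauge
  rw [if_neg h.not_isZero, if_pos h, if_neg h.not_isZero]
  by_cases hL : G.HConsec m i j ∧ G.VConsec n i j
  · have hL' : G.Linked m n i j := ⟨hL.1, hL.2, h.1⟩
    have hd : G.IsOne (i - 1) (j - 1) := by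
      obtain ⟨i, rfl⟩ := Nat.exists_eq_add_of_le' hL.1.1
      obtain ⟨j, rfl⟩ := Nat.exists_eq_add_of_le' hL.2.1
      exact (hU i j hi hj hL').mpr h
    rw [if_pos hL, if_pos hL', if_pos hd, if_neg fun h' : ¬ _ ∧ ¬ _ => h'.1 hL.1]
    have : ((if G.LeftOne i j then 1 - t else 1) * if G.BelowOne i j then 1 - t else 1) ≠ 0 := by
      split_ifs <;> simp [hτ]
    field_simp
  · have hL' : ¬ G.Linked m n i j := fun h' => hL ⟨h'.1, h'.2.1⟩
    have h1 := G.hConsec_of_leftOne hi h.1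
    have h2 := G.vConsec_of_belowOne hj h.1
    rw [if_neg hL, if_neg hL']
    by_cases hl : G.LeftOne i j <;> by_cases hb : G.BelowOne i j
    · exact absurd ⟨h1 hl, h2 hb⟩ hL
    · simp [hl, hb, h1 hl]
    · simp [hl, hb, h2 hb]
    · simp [hl, hb]

/-- The counterpart of `swWeight_mul_of_isOne` at the north-eastern corner. It involves the gauge of
the north-eastern vertex, which is expressed through the box beyond that vertex. -/
theorem _root_.HLRSK.Grid.Unmixed.neWeight_mul_of_isOne (hU : G.Unmixed m n)
    (ht1 : t < 1) {i j : ℕ} (h : G.IsOne i j) :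
    G.neWeight s t m n i j * G.vertexGauge s t m n (i + 1) (j + 1) *
      ((if G.AboveOne n i j then 1 - t else 1) * if G.RightOne m i j then 1 - t else 1) =
    (1 - t) * if ¬ G.HConsec m (i + 1) (j + 1) ∧ ¬ G.VConsec n (i + 1) (j + 1) then
      (1 - t ^ G.mult (i + 1) (j + 1) (G.h i (j + 1) + 1))⁻¹ else 1 := by
  have hτ : 1 - t ≠ 0 := by linarith
  have hNE : G.h i (j + 1) = G.v (i + 1) j := h.2.1.trans h.2.2.symm
  unfold neWeight vertexGauge
  rw [if_neg h.not_isZero, if_pos h]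
  by_cases hL : G.HConsec m (i + 1) (j + 1) ∧ G.VConsec n (i + 1) (j + 1)
  · have hm := hL.1.2.1
    have hn := hL.2.2.1
    have hL' : G.Linked m n (i + 1) (j + 1) := by
      refine ⟨hL.1, hL.2, ?_⟩
      have h1 := hL.1.2.2
      have h2 := hL.2.2.2
      simp only [Nat.add_sub_cancel] at h1 h2
      omega
    have hd : G.IsOne (i + 1) (j + 1) := (hU i j hm hn hL').mp h
    have ha : G.LeftOne (i + 1) (j + 1) ↔ G.AboveOne n i j := by
      simp [LeftOne, AboveOne, hn]
    have hr : G.BelowOne (i + 1) (j + 1) ↔ G.RightOne m i j := by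
      simp [BelowOne, RightOne, hm]
    rw [if_pos hL, if_pos hL', if_pos hd, if_neg hd.not_isZero,
      if_neg fun h' : ¬ _ ∧ ¬ _ => h'.1 hL.1]
    simp only [ha, hr]
    have : ((if G.AboveOne n i j then 1 - t else 1) * if G.RightOne m i j then 1 - t else 1)
        ≠ 0 := by
      split_ifs <;> simp [hτ]
    field_simp
  · have hL' : ¬ G.Linked m n (i + 1) (j + 1) := fun h' => hL ⟨h'.1, h'.2.1⟩
    have h1 := G.hConsec_of_rightOne (m := m) hNE
    have h2 := G.vConsec_of_aboveOne (n := n) hNE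
    rw [if_neg hL, if_neg hL']
    by_cases hl : G.RightOne m i j <;> by_cases hb : G.AboveOne n i j
    · exact absurd ⟨h1 hl, h2 hb⟩ hL
    · simp [hl, hb, h1 hl]
    · simp [hl, hb, h2 hb]
    · simp [hl, hb]

theorem swWeight_mul_of_isZero (hG : IsAdmissible m n mu rho lam nu G) (hU : G.Unmixed m n)
    {i j : ℕ} (hi : i < m) (hj : j < n) (h : G.IsZero i j) :
    G.swWeight s t m n i j * G.vertexGauge s t m n i j =
    s * if G.HConsec m i j ∧ G.VConsec n i j then (1 - t ^ (G.mult i j (G.h i j) - 1))⁻¹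
      else if ¬ G.HConsec m i j ∧ ¬ G.VConsec n i j then
        (1 - t ^ (G.mult i j (G.h i j) - 1)) / (1 - t ^ G.mult i j (G.h i j)) else 1 := by
  unfold swWeight vertexGauge
  rw [if_pos h, if_pos h]
  by_cases hL : G.HConsec m i j ∧ G.VConsec n i j
  · have hL' : G.Linked m n i j := ⟨hL.1, hL.2, h.1⟩
    have hd : G.IsZero (i - 1) (j - 1) := by
      obtain ⟨i, rfl⟩ := Nat.exists_eq_add_of_le' hL.1.1
      obtain ⟨j, rfl⟩ := Nat.exists_eq_add_of_le' hL.2.1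
      refine (hG.isZero_or_isOne_of_linked hi hj hL').1.resolve_right fun h1 => ?_
      exact h.not_isOne ((hU i j hi hj hL').mp h1)
    rw [if_pos hL, if_pos hL', if_pos hd, if_pos hL, one_mul, div_eq_mul_inv]
  · have hL' : ¬ G.Linked m n i j := fun h' => hL ⟨h'.1, h'.2.1⟩
    rw [if_neg hL, if_neg hL', if_neg hL, mul_one]

theorem neWeight_mul_of_isZero (hG : IsAdmissible m n mu rho lam nu G) (hU : G.Unmixed m n)
    {i j : ℕ} (h : G.IsZero i j) :
    G.neWeight s t m n i j * G.vertexGauge s t m n (i + 1) (j + 1) =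
    s * if G.HConsec m (i + 1) (j + 1) ∧ G.VConsec n (i + 1) (j + 1) then
        (1 - t ^ (G.mult (i + 1) (j + 1) (G.h i (j + 1) + 1) - 1))⁻¹
      else if ¬ G.HConsec m (i + 1) (j + 1) ∧ ¬ G.VConsec n (i + 1) (j + 1) then
        (1 - t ^ (G.mult (i + 1) (j + 1) (G.h i (j + 1) + 1) - 1)) /
          (1 - t ^ G.mult (i + 1) (j + 1) (G.h i (j + 1) + 1)) else 1 := by
  unfold neWeight vertexGauge
  rw [if_pos h]
  by_cases hL : G.HConsec m (i + 1) (j + 1) ∧ G.VConsec n (i + 1) (j + 1)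
  · have hm := hL.1.2.1
    have hn := hL.2.2.1
    have h1 := hL.1.2.2
    have h2 := hL.2.2.2
    simp only [Nat.add_sub_cancel] at h1 h2
    have hL' : G.Linked m n (i + 1) (j + 1) := by
      refine ⟨hL.1, hL.2, ?_⟩
      have h3 := h.2
      omega
    have hd : G.IsZero (i + 1) (j + 1) := by
      refine (hG.isZero_or_isOne_of_linked hm hn hL').2.resolve_right fun h1 => ?_
      exact h.not_isOne ((hU i j hm hn hL').mpr h1)
    rw [if_pos hL, if_pos hL', if_pos hd, if_pos hd, if_pos hL, one_mul, div_eq_mul_inv, h1]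
  · have hL' : ¬ G.Linked m n (i + 1) (j + 1) := fun h' => hL ⟨h'.1, h'.2.1⟩
    rw [if_neg hL, if_neg hL', if_neg hL, mul_one]

/-- Let `c` be the multiplicity of `r̄` at the south-eastern corner. Both sides are equal to `1 - t`,
times `1 - t ^ c` if neither the horizontal nor the vertical labels at this corner are consecutive. -/
theorem local_flip_of_isOne (hG : IsAdmissible m n mu rho lam nu G) (hU : G.Unmixed m n)
    (ht0 : 0 ≤ t) (ht1 : t < 1) {i j : ℕ} (hi : i < m) (hj : j < n) (h : G.IsOne i j) :
    G.swWeight s t m n i j * G.vertexGauge s t m n i j * G.hGauge t m n i j * G.vGauge t m n i j =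
    G.neWeight s t m n i j * G.vertexGauge s t m n (i + 1) (j + 1) * G.hGauge t m n i (j + 1) *
      G.vGauge t m n (i + 1) j := by
  have ⟨h0, h1, h2⟩ := h
  have hNE : G.h i (j + 1) = G.v (i + 1) j := h1.trans h2.symm
  have q1 := one_sub_pow_ne_zero ht0 ht1 (hG.mult_h_pos hi hj.le)
  have q2 := one_sub_pow_ne_zero ht0 ht1 (hG.mult_h_add_one_pos (j := j + 1) hi hj)
  have z1 : ¬ (1 ≤ j ∧ G.IsZero i (j - 1)) := by
    rintro ⟨hj1, hz⟩
    obtain ⟨j, rfl⟩ := Nat.exists_eq_add_of_le' hj1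
    exact hG.not_isZero_below hi hj h0 hz
  have z2 : ¬ (i + 1 < m ∧ G.IsZero (i + 1) j) := fun hz => hG.not_isZero_right hz.1 hj h hz.2
  have e1 : G.hGauge t m n i j =
      (if ¬ G.HConsec m (i + 1) j ∧ ¬ G.VConsec n (i + 1) j then
        1 - t ^ G.mult (i + 1) j (G.h i j + 1) else 1) *
      if G.BelowOne i j then 1 - t else 1 := by
    simp [hGauge, h2, z1, h, hj]
  have e2 : G.vGauge t m n i j =
      (if ¬ G.HConsec m i j ∧ ¬ G.VConsec n i j then 1 - t ^ G.mult i j (G.h i j) else 1) *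
      if G.LeftOne i j then 1 - t else 1 := by
    simp [vGauge, h0.symm, h.not_isZero, h, hi, and_comm]
  have e3 : G.vGauge t m n (i + 1) j =
      (if ¬ G.HConsec m (i + 1) j ∧ ¬ G.VConsec n (i + 1) j then
        1 - t ^ G.mult (i + 1) j (G.h i j + 1) else 1) *
      if G.RightOne m i j then 1 - t else 1 := by
    have c1 : (¬ G.VConsec n (i + 1) j ∧
        ¬ (G.HConsec m (i + 1) j ∧ G.h (i + 1) j = G.v (i + 1) j)) ↔
        ¬ G.HConsec m (i + 1) j ∧ ¬ G.VConsec n (i + 1) j := by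
      have : G.HConsec m (i + 1) j → G.h (i + 1) j = G.v (i + 1) j := by
        intro h'
        have := h'.2.2
        simp only [Nat.add_sub_cancel] at this
        omega
      tauto
    have c2 : (G.LeftOne (i + 1) j ∧ i + 1 < m ∧ G.IsOne (i + 1) j) ↔ G.RightOne m i j := by
      simp [LeftOne, RightOne, h]
    simp only [vGauge, c1, c2, z2, false_and, if_false, mul_one]
    rw [h2]
  have e4 : G.hGauge t m n i (j + 1) =
      (if ¬ G.HConsec m (i + 1) (j + 1) ∧ ¬ G.VConsec n (i + 1) (j + 1) then
        1 - t ^ G.mult (i + 1) (j + 1) (G.h i (j + 1) + 1) else 1) *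
      if G.AboveOne n i j then 1 - t else 1 := by
    have c1 : (¬ G.HConsec m (i + 1) (j + 1) ∧
        ¬ (G.VConsec n (i + 1) (j + 1) ∧ G.v (i + 1) (j + 1) = G.h i (j + 1) + 1)) ↔
        ¬ G.HConsec m (i + 1) (j + 1) ∧ ¬ G.VConsec n (i + 1) (j + 1) := by
      have : G.VConsec n (i + 1) (j + 1) → G.v (i + 1) (j + 1) = G.h i (j + 1) + 1 := by
        intro h'
        have := h'.2.2
        simp only [Nat.add_sub_cancel] at this
        omega
      tauto
    have c2 : (G.BelowOne i (j + 1) ∧ j + 1 < n ∧ G.IsOne i (j + 1)) ↔ G.AboveOne n i j := by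
      simp [BelowOne, AboveOne, h]
    simp only [hGauge, c1, c2, Nat.add_sub_cancel, h.not_isZero, and_false, false_and, if_false,
      mul_one]
  have w1 := hU.swWeight_mul_of_isOne (s := s) ht1 hi hj h
  have w2 := hU.neWeight_mul_of_isOne (s := s) ht1 h
  rw [e1, e2, e3, e4]
  set A := if ¬ G.HConsec m (i + 1) j ∧ ¬ G.VConsec n (i + 1) j then
        1 - t ^ G.mult (i + 1) j (G.h i j + 1) else 1
  trans (1 - t) * A
  · trans (G.swWeight s t m n i j * G.vertexGauge s t m n i j *
      ((if G.LeftOne i j then 1 - t else 1) * if G.BelowOne i j then 1 - t else 1)) * A *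
      (if ¬ G.HConsec m i j ∧ ¬ G.VConsec n i j then 1 - t ^ G.mult i j (G.h i j) else 1)
    · ring
    · rw [w1]
      split_ifs
      · field_simp
      · ring
  · symm
    trans (G.neWeight s t m n i j * G.vertexGauge s t m n (i + 1) (j + 1) *
      ((if G.AboveOne n i j then 1 - t else 1) * if G.RightOne m i j then 1 - t else 1)) * A *
      (if ¬ G.HConsec m (i + 1) (j + 1) ∧ ¬ G.VConsec n (i + 1) (j + 1) then
        1 - t ^ G.mult (i + 1) (j + 1) (G.h i (j + 1) + 1) else 1)
    · ring
    · rw [w2]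
      split_ifs
      · field_simp
      · ring

/-- Both sides are products of `s` and of factors `1 - t ^ c`, with `c` the multiplicity of `r + 1` or
of `r` at the south-eastern corner. The first is there if the horizontal labels at this corner are
not consecutive, the second if the vertical labels are not. -/
theorem local_flip_of_isZero (hG : IsAdmissible m n mu rho lam nu G) (hU : G.Unmixed m n)
    (ht0 : 0 ≤ t) (ht1 : t < 1) {i j : ℕ} (hi : i < m) (hj : j < n) (h : G.IsZero i j) :
    G.swWeight s t m n i j * G.vertexGauge s t m n i j * G.hGauge t m n i j * G.vGauge t m n i j =
    G.neWeight s t m n i j * G.vertexGauge s t m n (i + 1) (j + 1) * G.hGauge t m n i (j + 1) *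
      G.vGauge t m n (i + 1) j := by
  have ⟨h0, h1, h2⟩ := h
  obtain ⟨m1, m2, m3⟩ := hG.mult_of_isZero hi hj h
  obtain ⟨m4, m5, m6⟩ := hG.mult_top_of_isZero hi hj h
  have q1 := one_sub_pow_ne_zero ht0 ht1 (k := G.mult i j (G.h i j)) (by omega)
  have q2 := one_sub_pow_ne_zero ht0 ht1 (k := G.mult i j (G.h i j) - 1) (by omega)
  have q3 := one_sub_pow_ne_zero ht0 ht1 (k := G.mult (i + 1) (j + 1) (G.h i j + 1)) (by omega)
  have q4 := one_sub_pow_ne_zero ht0 ht1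
    (k := G.mult (i + 1) (j + 1) (G.h i j + 1) - 1) (by omega)
  have z1 : ¬ (1 ≤ j ∧ G.IsZero i (j - 1)) := by
    rintro ⟨hj1, hz⟩
    obtain ⟨j, rfl⟩ := Nat.exists_eq_add_of_le' hj1
    exact hG.not_isZero_below hi hj h0 hz
  have z2 : ¬ (i + 1 < m ∧ G.IsZero (i + 1) j) := by
    rintro ⟨hi1, hz⟩
    exact hG.not_isZero_left hi1 hj hz.1 h
  have f1 : ¬ G.IsOne i j := h.not_isOne
  have e1 : G.hGauge t m n i j =
      if G.HConsec m (i + 1) j then 1 else 1 - t ^ G.mult (i + 1) j (G.h i j + 1) := by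
    simp [hGauge, h2, z1, f1]
  have e2 : G.vGauge t m n i j =
      (if ¬ G.VConsec n i j ∧ ¬ G.HConsec m i j then 1 - t ^ G.mult i j (G.h i j) else 1) *
      if G.HConsec m i j then 1 - t ^ (G.mult i j (G.h i j) - 1) else 1 := by
    simp [vGauge, ← h0, m2, f1, h, hi]
  have e3 : G.vGauge t m n (i + 1) j =
      if G.VConsec n i j then 1 else 1 - t ^ (G.mult i j (G.h i j) - 1) := by
    have : ¬ (G.HConsec m (i + 1) j ∧ G.h (i + 1) j = G.v (i + 1) j) := fun h' =>
      hG.not_isZero_left h'.1.2.1 hj h'.2 h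
    simp only [vGauge, this, not_false_eq_true, and_true]
    simp [z2, h2, m3, LeftOne, f1, hG.vConsec_right_of_isZero hi hj h]
  have e4 : G.hGauge t m n i (j + 1) =
      (if ¬ G.HConsec m (i + 1) (j + 1) ∧ ¬ G.VConsec n (i + 1) (j + 1) then
        1 - t ^ G.mult (i + 1) (j + 1) (G.h i j + 1) else 1) *
      if G.VConsec n (i + 1) (j + 1) then
        1 - t ^ (G.mult (i + 1) (j + 1) (G.h i j + 1) - 1) else 1 := by
    have c1 : (¬ G.HConsec m (i + 1) (j + 1) ∧
        ¬ (G.VConsec n (i + 1) (j + 1) ∧ G.v (i + 1) (j + 1) = G.h i (j + 1) + 1)) ↔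
        ¬ G.HConsec m (i + 1) (j + 1) ∧ ¬ G.VConsec n (i + 1) (j + 1) := by
      have : G.VConsec n (i + 1) (j + 1) → G.v (i + 1) (j + 1) = G.h i (j + 1) + 1 := by
        intro h'
        have := h'.2.2
        simp only [Nat.add_sub_cancel] at this
        omega
      tauto
    simp only [hGauge, c1]
    simp [BelowOne, h, f1, h1, m5]
  have w1 := hG.swWeight_mul_of_isZero (s := s) (t := t) hU hi hj h
  have w2 := hG.neWeight_mul_of_isZero (s := s) (t := t) hU h
  rw [e1, e2, e3, e4, w1, w2, m6, h1]
  have hH := hG.hConsec_right_of_isZero hi hj h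
  rw [← hH]
  by_cases a1 : G.HConsec m i j <;> by_cases a2 : G.VConsec n i j <;>
    by_cases a3 : G.HConsec m (i + 1) (j + 1) <;>
    by_cases a4 : G.VConsec n (i + 1) (j + 1) <;>
    simp only [a1, a2, a3, a4, if_true, if_false, not_true_eq_false, not_false_eq_true, and_self,
      and_true, and_false, mul_one, one_mul] <;> field_simp

/-- For a trivial box only the gauge factors of the four edges matter. They interact only if
`v = h + 1`: then the move of one particle changes the multiplicity seen by the other. -/
theorem local_flip_of_isTrivial (hG : IsAdmissible m n mu rho lam nu G)
    {i j : ℕ} (hi : i < m) (hj : j < n) (h : G.IsTrivial i j) :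
    G.swWeight s t m n i j * G.vertexGauge s t m n i j * G.hGauge t m n i j * G.vGauge t m n i j =
    G.neWeight s t m n i j * G.vertexGauge s t m n (i + 1) (j + 1) * G.hGauge t m n i (j + 1) *
      G.vGauge t m n (i + 1) j := by
  have ⟨h1, h0, h2⟩ := h
  have w1 : G.swWeight s t m n i j = 1 := by
    simp [swWeight, h.not_isZero, h.not_isOne]
  have w2 : G.neWeight s t m n i j = 1 := by
    simp [neWeight, h.not_isZero, h.not_isOne]
  have k1 : G.vertexGauge s t m n i j = 1 := if_neg fun h' => h0 h'.2.2
  have k2 : G.vertexGauge s t m n (i + 1) (j + 1) = 1 := by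
    refine if_neg fun h' => h0 ?_
    have c1 := h'.1.2.2
    have c2 := h'.2.1.2.2
    have c3 := h'.2.2
    simp only [Nat.add_sub_cancel] at c1 c2
    omega
  have e1 : G.hGauge t m n i j =
      (if ¬ G.HConsec m (i + 1) j ∧ ¬ (G.VConsec n (i + 1) j ∧ G.v i j = G.h i j + 1) then
        1 - t ^ G.mult (i + 1) j (G.h i j + 1) else 1) *
      if (1 ≤ j ∧ G.IsZero i (j - 1)) ∧ G.VConsec n (i + 1) j then
        1 - t ^ G.mult i j (G.h i j + 1) else 1 := by
    simp [hGauge, h.not_isOne, h2]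
  have e2 : G.vGauge t m n i j = if G.VConsec n i j then 1 else 1 - t ^ G.mult i j (G.v i j) := by
    simp [vGauge, h.not_isOne, h.not_isZero, h0]
  have e3 : G.hGauge t m n i (j + 1) =
      if G.HConsec m (i + 1) (j + 1) then 1 else
        1 - t ^ G.mult (i + 1) (j + 1) (G.h i j + 1) := by
    have : ¬ (G.VConsec n (i + 1) (j + 1) ∧ G.v (i + 1) (j + 1) = G.h i (j + 1) + 1) := by
      rintro ⟨c1, c2⟩
      have := c1.2.2
      simp only [Nat.add_sub_cancel] at this
      omega
    simp only [hGauge, this, not_false_eq_true, and_true]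
    simp [BelowOne, h.not_isOne, h.not_isZero, ← h1]
  have e4 : G.vGauge t m n (i + 1) j =
      (if ¬ G.VConsec n (i + 1) j ∧
          ¬ (G.HConsec m (i + 1) j ∧ G.h (i + 1) j = G.v i j) then
        1 - t ^ G.mult (i + 1) j (G.v i j) else 1) *
      if (i + 1 < m ∧ G.IsZero (i + 1) j) ∧ G.HConsec m (i + 1) j then
        1 - t ^ G.mult (i + 1) (j + 1) (G.v i j) else 1 := by
    simp [vGauge, LeftOne, h.not_isOne, ← h2]
  rw [w1, w2, k1, k2, e1, e2, e3, e4]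
  have hH : G.HConsec m (i + 1) j → G.h (i + 1) j = G.h i j + 1 := fun h' => by
    have := h'.2.2
    simpa using this.symm
  by_cases hv : G.v i j = G.h i j + 1
  · have c1 := hG.vConsec_iff_of_trivial hi hj h hv
    have c2 := hG.hConsec_iff_of_trivial hi hj h hv
    have c3 : (G.HConsec m (i + 1) j ∧ G.h (i + 1) j = G.h i j + 1) ↔ G.HConsec m (i + 1) j :=
      and_iff_left_of_imp hH
    have c4 : G.mult (i + 1) (j + 1) (G.h i j + 1) = G.mult i j (G.h i j + 1) := by
      have m1 := hG.mult_h hi hj.le (G.h i j + 1)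
      have m2 := hG.mult_v (i := i + 1) hi hj (G.h i j + 1)
      rw [← h2, hv] at m2
      simp at m1 m2
      omega
    simp only [← c1, ← c2, hv, c3, c4]
    by_cases a1 : G.HConsec m (i + 1) j <;> by_cases a2 : G.VConsec n (i + 1) j <;>
      by_cases a3 : G.HConsec m (i + 1) (j + 1) <;> by_cases a4 : G.VConsec n i j <;>
      simp [a1, a2, a3, a4, mul_comm]
  · have c1 := hG.vConsec_right_of_trivial hi hj h hv
    have c2 := hG.hConsec_top_of_trivial hi hj h hv
    have c3 : G.mult (i + 1) (j + 1) (G.h i j + 1) = G.mult (i + 1) j (G.h i j + 1) := by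
      have m2 := hG.mult_v (i := i + 1) hi hj (G.h i j + 1)
      rw [← h2, if_neg (Ne.symm hv), if_neg (by omega)] at m2
      omega
    have c4 : G.mult (i + 1) j (G.v i j) = G.mult i j (G.v i j) := by
      have m2 := hG.mult_h hi hj.le (G.v i j)
      rw [if_neg hv, if_neg (Ne.symm h0)] at m2
      omega
    have c5 : ¬ ((1 ≤ j ∧ G.IsZero i (j - 1)) ∧ G.VConsec n (i + 1) j) := by
      rintro ⟨⟨hj1, hz⟩, hV'⟩
      obtain ⟨j, rfl⟩ := Nat.exists_eq_add_of_le' hj1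
      have d1 := hV'.2.2
      have d2 := hz.2
      have d3 := hz.1
      simp only [Nat.add_sub_cancel] at d1 d2 d3
      omega
    have c6 : ¬ ((i + 1 < m ∧ G.IsZero (i + 1) j) ∧ G.HConsec m (i + 1) j) := by
      rintro ⟨⟨hi1, hz⟩, hH'⟩
      have d1 := hH hH'
      have d2 := hz.1
      omega
    have c7 : ¬ (G.HConsec m (i + 1) j ∧ G.h (i + 1) j = G.v i j) := fun h' => by
      have := hH h'.1
      omega
    rw [if_neg c5, if_neg c6, c1, c2, c3, c4]
    simp only [hv, c7, and_false, not_false_eq_true, and_true]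
    by_cases a1 : G.HConsec m (i + 1) j <;> by_cases a2 : G.VConsec n i j <;> simp [a1, a2]

/-- The flip property, box by box: up to gauge factors that cancel between adjacent boxes, the
weight of a box equals the weight of its image. -/
theorem local_flip (hG : IsAdmissible m n mu rho lam nu G) (hU : G.Unmixed m n)
    (ht0 : 0 ≤ t) (ht1 : t < 1) {i j : ℕ} (hi : i < m) (hj : j < n) :
    G.swWeight s t m n i j * G.vertexGauge s t m n i j * G.hGauge t m n i j * G.vGauge t m n i j =
    G.neWeight s t m n i j * G.vertexGauge s t m n (i + 1) (j + 1) * G.hGauge t m n i (j + 1) *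
      G.vGauge t m n (i + 1) j := by
  rcases hG.isTrivial_or hi hj with h | h | h
  · exact hG.local_flip_of_isTrivial hi hj h
  · exact hG.local_flip_of_isZero hU ht0 ht1 hi hj h
  · exact hG.local_flip_of_isOne hU ht0 ht1 hi hj h

end Gauge

end IsAdmissible

/-! ### Multiplying the local identities over the rectangle -/

/-- A local identity between two arrays of weights on a rectangle, up to gauge factors `K` on
vertices, `f` on horizontal and `g` on vertical edges, leaves only boundary factors in the product
over all boxes. -/
theorem prod_rectangle_of_local {m n : ℕ} {w w' K f g : ℕ → ℕ → ℝ}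
    (hloc : ∀ i j, i < m → j < n →
      w i j * K i j * f i j * g i j = w' i j * K (i + 1) (j + 1) * f i (j + 1) * g (i + 1) j)
    (hK : ∀ i j, i < m → j < n → K i j ≠ 0)
    (hK0 : ∀ i j, i = 0 ∨ j = 0 ∨ i = m ∨ j = n → K i j = 1)
    (hf : ∀ i j, i < m → j ≤ n → f i j ≠ 0) (hg : ∀ i j, i ≤ m → j < n → g i j ≠ 0) :
    (∏ i ∈ Finset.range m, ∏ j ∈ Finset.range n, w i j) *
        ((∏ i ∈ Finset.range m, f i 0) * ∏ j ∈ Finset.range n, g 0 j) =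
      (∏ i ∈ Finset.range m, ∏ j ∈ Finset.range n, w' i j) *
        ((∏ i ∈ Finset.range m, f i n) * ∏ j ∈ Finset.range n, g m j) := by
  have h1 : ∏ i ∈ Finset.range m, ∏ j ∈ Finset.range n, w i j * K i j * f i j * g i j =
      ∏ i ∈ Finset.range m, ∏ j ∈ Finset.range n,
        w' i j * K (i + 1) (j + 1) * f i (j + 1) * g (i + 1) j :=
    Finset.prod_congr rfl fun i hi => Finset.prod_congr rfl fun j hj =>
      hloc i j (Finset.mem_range.mp hi) (Finset.mem_range.mp hj)
  simp only [Finset.prod_mul_distrib] at h1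
  have h2 : ∏ i ∈ Finset.range m, ∏ j ∈ Finset.range n, K (i + 1) (j + 1) =
      ∏ i ∈ Finset.range m, ∏ j ∈ Finset.range n, K i j := by
    trans ∏ i ∈ Finset.range (m + 1), ∏ j ∈ Finset.range (n + 1), K i j
    · rw [Finset.prod_range_succ']
      simp only [Finset.prod_range_succ', hK0 _ 0 (by simp), hK0 0 _ (by simp)]
      simp
    · rw [Finset.prod_range_succ]
      simp only [Finset.prod_range_succ, hK0 _ n (by simp), hK0 m _ (by simp)]
      simp
  have h3 : (∏ i ∈ Finset.range m, ∏ j ∈ Finset.range n, f i j) * ∏ i ∈ Finset.range m, f i n =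
      (∏ i ∈ Finset.range m, ∏ j ∈ Finset.range n, f i (j + 1)) *
        ∏ i ∈ Finset.range m, f i 0 := by
    simp only [← Finset.prod_mul_distrib, ← Finset.prod_range_succ, ← Finset.prod_range_succ']
  have h4 : (∏ i ∈ Finset.range m, ∏ j ∈ Finset.range n, g i j) * ∏ j ∈ Finset.range n, g m j =
      (∏ i ∈ Finset.range m, ∏ j ∈ Finset.range n, g (i + 1) j) *
        ∏ j ∈ Finset.range n, g 0 j := by
    rw [← Finset.prod_range_succ (fun i => ∏ j ∈ Finset.range n, g i j),
      ← Finset.prod_range_succ' (fun i => ∏ j ∈ Finset.range n, g i j)]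
  have n1 : ∏ i ∈ Finset.range m, ∏ j ∈ Finset.range n, K i j ≠ 0 :=
    Finset.prod_ne_zero_iff.mpr fun i hi => Finset.prod_ne_zero_iff.mpr fun j hj =>
      hK i j (Finset.mem_range.mp hi) (Finset.mem_range.mp hj)
  have n2 : ∏ i ∈ Finset.range m, ∏ j ∈ Finset.range n, f i j ≠ 0 :=
    Finset.prod_ne_zero_iff.mpr fun i hi => Finset.prod_ne_zero_iff.mpr fun j hj =>
      hf i j (Finset.mem_range.mp hi) (Finset.mem_range.mp hj).le
  have n3 : ∏ i ∈ Finset.range m, ∏ j ∈ Finset.range n, g i j ≠ 0 :=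
    Finset.prod_ne_zero_iff.mpr fun i hi => Finset.prod_ne_zero_iff.mpr fun j hj =>
      hg i j (Finset.mem_range.mp hi).le (Finset.mem_range.mp hj)
  rw [h2] at h1
  generalize (∏ i ∈ Finset.range m, ∏ j ∈ Finset.range n, w i j) = W at *
  generalize (∏ i ∈ Finset.range m, ∏ j ∈ Finset.range n, w' i j) = W' at *
  generalize (∏ i ∈ Finset.range m, ∏ j ∈ Finset.range n, K i j) = PK at *
  generalize (∏ i ∈ Finset.range m, ∏ j ∈ Finset.range n, f i j) = F at *
  generalize (∏ i ∈ Finset.range m, ∏ j ∈ Finset.range n, g i j) = P at *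
  generalize (∏ i ∈ Finset.range m, ∏ j ∈ Finset.range n, f i (j + 1)) = F' at *
  generalize (∏ i ∈ Finset.range m, ∏ j ∈ Finset.range n, g (i + 1) j) = P' at *
  generalize (∏ i ∈ Finset.range m, f i n) = a at *
  generalize (∏ i ∈ Finset.range m, f i 0) = b at *
  generalize (∏ j ∈ Finset.range n, g m j) = c at *
  generalize (∏ j ∈ Finset.range n, g 0 j) = d at *
  refine mul_left_cancel₀ (mul_ne_zero n1 (mul_ne_zero n2 n3)) ?_
  linear_combination b * d * h1 - W' * PK * P * c * h3 - W' * PK * F' * b * h4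

namespace IsAdmissible

open Grid

variable {N m n : ℕ} {mu rho lam nu : Sig N} {G : Grid N} {s t : ℝ}

theorem vertexGauge_ne_zero (hG : IsAdmissible m n mu rho lam nu G) (hs : s ≠ 0) (ht0 : 0 ≤ t)
    (ht1 : t < 1) {i j : ℕ} (hi : i < m) (hj : j < n) : G.vertexGauge s t m n i j ≠ 0 := by
  have hτ : 1 - t ≠ 0 := by linarith
  unfold vertexGauge
  split_ifs with h1 h2
  · have := (hG.mult_of_isZero hi hj h2).1
    exact div_ne_zero hs (one_sub_pow_ne_zero ht0 ht1 (by omega))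
  all_goals simp [hτ]

theorem hGauge_ne_zero (hG : IsAdmissible m n mu rho lam nu G) (ht0 : 0 ≤ t) (ht1 : t < 1)
    {i j : ℕ} (hi : i < m) (hj : j ≤ n) : G.hGauge t m n i j ≠ 0 := by
  have hτ : 1 - t ≠ 0 := by linarith
  refine mul_ne_zero (mul_ne_zero ?_ ?_) (by split_ifs <;> simp [hτ])
  · split_ifs
    · exact one_sub_pow_ne_zero ht0 ht1 (hG.mult_h_add_one_pos hi hj)
    · exact one_ne_zero
  · split_ifs with h
    · obtain ⟨⟨hj1, hz⟩, -⟩ := h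
      obtain ⟨j, rfl⟩ := Nat.exists_eq_add_of_le' hj1
      have := hG.mult_top_of_isZero hi hj hz
      rw [Nat.add_sub_cancel] at hz
      rw [hz.2.1]
      exact one_sub_pow_ne_zero ht0 ht1 (by omega)
    · exact one_ne_zero

theorem vGauge_ne_zero (hG : IsAdmissible m n mu rho lam nu G) (ht0 : 0 ≤ t) (ht1 : t < 1)
    {i j : ℕ} (hi : i ≤ m) (hj : j < n) : G.vGauge t m n i j ≠ 0 := by
  have hτ : 1 - t ≠ 0 := by linarith
  refine mul_ne_zero (mul_ne_zero ?_ ?_) (by split_ifs <;> simp [hτ])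
  · split_ifs
    · exact one_sub_pow_ne_zero ht0 ht1 (hG.mult_v_pos hi hj)
    · exact one_ne_zero
  · split_ifs with h
    · obtain ⟨⟨him, hz⟩, -⟩ := h
      have := hG.mult_of_isZero him hj hz
      rw [← hz.1]
      exact one_sub_pow_ne_zero ht0 ht1 (by omega)
    · exact one_ne_zero

/-- A linked vertex between boxes of different types makes the weights on both sides of the flip
property vanish. -/
theorem exists_weights_eq_zero (hG : IsAdmissible m n mu rho lam nu G) (hU : ¬ G.Unmixed m n) :
    ∃ i j, i + 1 < m ∧ j + 1 < n ∧
      G.swWeight s t m n (i + 1) (j + 1) = 0 ∧ G.neWeight s t m n i j = 0 := by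
  unfold Unmixed at hU
  push Not at hU
  obtain ⟨i, j, hi, hj, hL, hne⟩ := hU
  have hHV : G.HConsec m (i + 1) (j + 1) ∧ G.VConsec n (i + 1) (j + 1) := ⟨hL.1, hL.2.1⟩
  refine ⟨i, j, hi, hj, ?_⟩
  unfold swWeight neWeight
  simp only [if_pos hHV, Nat.add_sub_cancel]
  rcases hG.isZero_or_isOne_of_linked hi hj hL with ⟨h1 | h1, h2 | h2⟩
  · have := h1.not_isOne
    have := h2.not_isOne
    tauto
  · simp [h1, h2, h2.not_isZero, h1.not_isOne]
  · simp [h1, h2, h1.not_isZero, h2.not_isOne]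
  · tauto

theorem continuous_swWeight (G : Grid N) (t : ℝ) (m n i j : ℕ) :
    Continuous fun s => G.swWeight s t m n i j := by
  unfold swWeight
  split_ifs <;> fun_prop

theorem continuous_neWeight (G : Grid N) (t : ℝ) (m n i j : ℕ) :
    Continuous fun s => G.neWeight s t m n i j := by
  unfold neWeight
  split_ifs <;> fun_prop

/-- The flip property in the product form, for one admissible function. -/
theorem prod_swWeight_mul (hG : IsAdmissible m n mu rho lam nu G) (ht0 : 0 ≤ t) (ht1 : t < 1) :
    (∏ i ∈ Finset.range m, ∏ j ∈ Finset.range n, G.swWeight s t m n i j) *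
        ((∏ i ∈ Finset.range m, G.hGauge t m n i 0) * ∏ j ∈ Finset.range n, G.vGauge t m n 0 j) =
      (∏ i ∈ Finset.range m, ∏ j ∈ Finset.range n, G.neWeight s t m n i j) *
        ((∏ i ∈ Finset.range m, G.hGauge t m n i n) *
          ∏ j ∈ Finset.range n, G.vGauge t m n m j) := by
  by_cases hU : G.Unmixed m n
  · -- For `s ≠ 0` the gauge factors can be cancelled; the case `s = 0` follows by continuity.
    have key : ∀ s : ℝ, s ≠ 0 →
      (∏ i ∈ Finset.range m, ∏ j ∈ Finset.range n, G.swWeight s t m n i j) *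
        ((∏ i ∈ Finset.range m, G.hGauge t m n i 0) * ∏ j ∈ Finset.range n, G.vGauge t m n 0 j) =
      (∏ i ∈ Finset.range m, ∏ j ∈ Finset.range n, G.neWeight s t m n i j) *
        ((∏ i ∈ Finset.range m, G.hGauge t m n i n) *
          ∏ j ∈ Finset.range n, G.vGauge t m n m j) := by
      intro s hs
      refine prod_rectangle_of_local (K := G.vertexGauge s t m n)
        (fun i j hi hj => hG.local_flip hU ht0 ht1 hi hj)
        (fun i j hi hj => hG.vertexGauge_ne_zero hs ht0 ht1 hi hj) (fun i j h => if_neg ?_)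
        (fun i j hi hj => hG.hGauge_ne_zero ht0 ht1 hi hj)
        (fun i j hi hj => hG.vGauge_ne_zero ht0 ht1 hi hj)
      rintro ⟨⟨h1, h2, -⟩, ⟨h3, h4, -⟩, -⟩
      omega
    have h1 : Continuous fun s => (∏ i ∈ Finset.range m, ∏ j ∈ Finset.range n,
        G.swWeight s t m n i j) * ((∏ i ∈ Finset.range m, G.hGauge t m n i 0) *
          ∏ j ∈ Finset.range n, G.vGauge t m n 0 j) :=
      (continuous_finsetProd _ fun i _ => continuous_finsetProd _ fun j _ =>
        continuous_swWeight G t m n i j).mul continuous_const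
    have h2 : Continuous fun s => (∏ i ∈ Finset.range m, ∏ j ∈ Finset.range n,
        G.neWeight s t m n i j) * ((∏ i ∈ Finset.range m, G.hGauge t m n i n) *
          ∏ j ∈ Finset.range n, G.vGauge t m n m j) :=
      (continuous_finsetProd _ fun i _ => continuous_finsetProd _ fun j _ =>
        continuous_neWeight G t m n i j).mul continuous_const
    exact congrFun (h1.ext_on (dense_compl_singleton (0 : ℝ)) h2 fun s hs => key s hs) s
  · obtain ⟨i, j, hi, hj, h1, h2⟩ := hG.exists_weights_eq_zero (s := s) (t := t) hU
    have e1 : ∏ i ∈ Finset.range m, ∏ j ∈ Finset.range n, G.swWeight s t m n i j = 0 :=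
      Finset.prod_eq_zero (Finset.mem_range.mpr hi)
        (Finset.prod_eq_zero (Finset.mem_range.mpr hj) h1)
    have e2 : ∏ i ∈ Finset.range m, ∏ j ∈ Finset.range n, G.neWeight s t m n i j = 0 :=
      Finset.prod_eq_zero (Finset.mem_range.mpr ((Nat.lt_succ_self i).trans hi))
        (Finset.prod_eq_zero (Finset.mem_range.mpr ((Nat.lt_succ_self j).trans hj)) h2)
    rw [e1, e2, zero_mul, zero_mul]

end IsAdmissible

/-! ### Paths of moving particles and the functions `φ`, `ψ` -/

/-- The signatures `σ 0, …, σ m` arise by moving one particle after another from the positions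
`a 0 < a 1 < ⋯ < a (m - 1)`. -/
structure IsPath {N : ℕ} (m : ℕ) (σ : ℕ → Sig N) (a : ℕ → ℤ) : Prop where
  moves : ∀ k < m, (σ k).Moves (σ (k + 1)) (a k)
  lt_succ : ∀ k, k + 1 < m → a k < a (k + 1)

theorem IsAdmissible.row {N m n : ℕ} {mu rho lam nu : Sig N} {G : Grid N}
    (hG : IsAdmissible m n mu rho lam nu G) {j : ℕ} (hj : j ≤ n) :
    IsPath m (fun i => G.val i j) (fun i => G.h i j) :=
  ⟨fun k hk => hG.move_h k j hk hj, fun _ hk => hG.h_lt' hk hj⟩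

theorem IsAdmissible.column {N m n : ℕ} {mu rho lam nu : Sig N} {G : Grid N}
    (hG : IsAdmissible m n mu rho lam nu G) {i : ℕ} (hi : i ≤ m) :
    IsPath n (G.val i) (G.v i) :=
  ⟨fun k hk => hG.move_v i k hi hk, fun _ hk => hG.v_lt' hi hk⟩

namespace IsPath

variable {N m : ℕ} {σ σ' : ℕ → Sig N} {a a' : ℕ → ℤ}

theorem lt (h : IsPath m σ a) {i k : ℕ} (hik : i < k) (hk : k < m) : a i < a k := by
  induction k, hik using Nat.le_induction with
  | base => exact h.lt_succ i hk
  | succ k _ ih => exact (ih (by omega)).trans (h.lt_succ k hk)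

theorem lt_iff (h : IsPath m σ a) {i k : ℕ} (hi : i < m) (hk : k < m) : a i < a k ↔ i < k := by
  refine ⟨fun hlt => ?_, fun hik => h.lt hik hk⟩
  by_contra! hki
  rcases hki.eq_or_lt with rfl | hki
  · exact lt_irrefl _ hlt
  · exact lt_asymm hlt (h.lt hki hi)

open scoped Classical in
theorem above (h : IsPath m σ a) {k : ℕ} (hk : k ≤ m) (x : ℤ) :
    (σ k).above x = (σ 0).above x + if ∃ i < k, a i = x then 1 else 0 := by
  induction k with
  | zero => simp
  | succ k ih =>
    rw [(h.moves k hk).above, ih (by omega)]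
    have h1 : (∃ i < k + 1, a i = x) ↔ (∃ i < k, a i = x) ∨ x = a k := by
      simp only [Nat.lt_succ_iff_lt_or_eq, or_and_right, exists_or, exists_eq_left, eq_comm (a := x)]
    by_cases hx : x = a k
    · have h2 : ¬ ∃ i < k, a i = x := by
        rintro ⟨i, hi, hix⟩
        have := h.lt hi (by omega)
        omega
      rw [if_neg h2, if_pos hx, if_pos (h1.mpr (Or.inr hx))]
    · simp only [h1, hx, or_false, if_false, add_zero]

open scoped Classical in
theorem count (h : IsPath m σ a) {k : ℕ} (hk : k ≤ m) (x : ℤ) :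
    (σ k).count x + (if ∃ i < k, a i = x then 1 else 0) =
      (σ 0).count x + if ∃ i < k, a i + 1 = x then 1 else 0 := by
  have h1 := h.above hk x
  have h2 := h.above hk (x - 1)
  have h3 := (σ k).count_add_above x
  have h4 := (σ 0).count_add_above x
  simp only [eq_sub_iff_add_eq] at h2
  omega

open scoped Classical in
/-- `φ` as a product over the moves of a path. A move contributes unless the next move leaves the
position that it reaches. -/
theorem phi_eq (h : IsPath m σ a) (t : ℝ) (hI : Interlace (σ 0) (σ m)) :
    phi t (σ m) (σ 0) = ∏ i ∈ Finset.range m,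
      if i + 1 < m ∧ a i + 1 = a (i + 1) then 1 else 1 - t ^ (σ (i + 1)).count (a i + 1) := by
  -- The level reached by the particle `i` is left again only by the next particle.
  have hx : ∀ i < m, ∀ k, i + 1 ≤ k → k ≤ m → ((∃ i' < k, a i' = a i + 1) ↔
      i + 1 < k ∧ a i + 1 = a (i + 1)) := by
    intro i hi k hik hk
    constructor
    · rintro ⟨i', hi', e⟩
      have h1 : i < i' := (h.lt_iff hi (by omega)).mp (by omega)
      have h2 := h.lt_succ i (by omega)
      rcases Nat.lt_or_ge (i + 1) i' with h3 | h3
      · have := h.lt h3 (by omega)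
        omega
      · obtain rfl : i' = i + 1 := by omega
        exact ⟨hi', e.symm⟩
    · rintro ⟨h1, h2⟩
      exact ⟨i + 1, h1, h2.symm⟩
  rw [phi_eq_prod t hI (((Finset.range m).filter
    fun i => ¬ (i + 1 < m ∧ a i + 1 = a (i + 1))).image fun i => a i + 1)]
  · rw [Finset.prod_image]
    · rw [Finset.prod_filter]
      refine Finset.prod_congr rfl fun i hi => ?_
      rw [Finset.mem_range] at hi
      by_cases hc : i + 1 < m ∧ a i + 1 = a (i + 1)
      · rw [if_neg (not_not.mpr hc), if_pos hc]
      · rw [if_pos hc, if_neg hc]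
        have c1 := h.count le_rfl (a i + 1)
        have c2 := h.count (k := i + 1) hi (a i + 1)
        rw [if_neg (by rwa [hx i hi m hi le_rfl]), if_pos ⟨i, hi, rfl⟩] at c1
        rw [if_neg (by rw [hx i hi (i + 1) le_rfl hi]; omega),
          if_pos ⟨i, Nat.lt_succ_self i, rfl⟩] at c2
        congr 2
        omega
    · intro i hi k hk hik
      simp only [Finset.coe_filter, Finset.mem_range, Set.mem_ofPred_eq] at hi hk
      have h1 := h.lt_iff hi.1 hk.1
      have h2 := h.lt_iff hk.1 hi.1
      dsimp only at hik
      omega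
  · intro x
    have c1 := h.count le_rfl x
    simp only [Finset.mem_image, Finset.mem_filter, Finset.mem_range]
    constructor
    · rintro ⟨i, ⟨hi, hc⟩, rfl⟩
      rw [if_neg (by rwa [hx i hi m hi le_rfl]), if_pos ⟨i, hi, rfl⟩] at c1
      omega
    · intro hc
      by_cases h1 : ∃ i < m, a i + 1 = x
      · obtain ⟨i, hi, rfl⟩ := h1
        refine ⟨i, ⟨hi, ?_⟩, rfl⟩
        rw [← hx i hi m hi le_rfl]
        intro h2
        rw [if_pos h2, if_pos ⟨i, hi, rfl⟩] at c1
        omega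
      · rw [if_neg h1] at c1
        omega

open scoped Classical in
/-- `ψ` as a product over the moves of a path. A move contributes unless the previous move reaches
the position that it leaves. -/
theorem psi_eq (h : IsPath m σ a) (t : ℝ) (hI : Interlace (σ 0) (σ m)) :
    psi t (σ m) (σ 0) = ∏ j ∈ Finset.range m,
      if 1 ≤ j ∧ a (j - 1) + 1 = a j then 1 else 1 - t ^ (σ j).count (a j) := by
  -- The level left by the particle `j` is reached only by the previous particle.
  have hx : ∀ j < m, ∀ k, j ≤ k → k ≤ m → ((∃ i < k, a i + 1 = a j) ↔
      1 ≤ j ∧ a (j - 1) + 1 = a j) := by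
    intro j hj k hjk hk
    constructor
    · rintro ⟨i, hi, e⟩
      have h1 : i < j := (h.lt_iff (by omega) hj).mp (by omega)
      obtain ⟨j, rfl⟩ := Nat.exists_eq_add_of_le' (Nat.one_le_of_lt h1)
      have h2 := h.lt_succ j (by omega)
      rcases Nat.lt_or_ge i j with h3 | h3
      · have := h.lt h3 (by omega)
        omega
      · obtain rfl : i = j := by omega
        exact ⟨by omega, e⟩
    · rintro ⟨h1, h2⟩
      exact ⟨j - 1, by omega, h2⟩
  rw [psi_eq_prod t hI (((Finset.range m).filter
    fun j => ¬ (1 ≤ j ∧ a (j - 1) + 1 = a j)).image a)]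
  · rw [Finset.prod_image]
    · rw [Finset.prod_filter]
      refine Finset.prod_congr rfl fun j hj => ?_
      rw [Finset.mem_range] at hj
      by_cases hc : 1 ≤ j ∧ a (j - 1) + 1 = a j
      · rw [if_neg (not_not.mpr hc), if_pos hc]
      · rw [if_pos hc, if_neg hc]
        have c2 := h.count (k := j) hj.le (a j)
        have h3 : ¬ ∃ i < j, a i = a j := by
          rintro ⟨i, hi, e⟩
          have := h.lt hi hj
          omega
        rw [if_neg h3, if_neg (by rwa [hx j hj j le_rfl hj.le])] at c2
        congr 2
        omega
    · intro i hi k hk hik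
      simp only [Finset.coe_filter, Finset.mem_range, Set.mem_ofPred_eq] at hi hk
      have h1 := h.lt_iff hi.1 hk.1
      have h2 := h.lt_iff hk.1 hi.1
      omega
  · intro x
    have c1 := h.count le_rfl x
    simp only [Finset.mem_image, Finset.mem_filter, Finset.mem_range]
    constructor
    · rintro ⟨j, ⟨hj, hc⟩, rfl⟩
      rw [if_neg (c := ∃ i < m, a i + 1 = a j) (by rwa [hx j hj m hj.le le_rfl]),
        if_pos ⟨j, hj, rfl⟩] at c1
      omega
    · intro hc
      by_cases h1 : ∃ j < m, a j = x
      · obtain ⟨j, hj, rfl⟩ := h1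
        refine ⟨j, ⟨hj, ?_⟩, rfl⟩
        rw [← hx j hj m hj.le le_rfl]
        intro h2
        rw [if_pos h2, if_pos ⟨j, hj, rfl⟩] at c1
        omega
      · rw [if_neg h1] at c1
        omega

/-- The moves are determined by the endpoints of the path. -/
theorem label_unique (h : IsPath m σ a) (h' : IsPath m σ' a') (h0 : σ 0 = σ' 0)
    (hm : σ m = σ' m) {i : ℕ} (hi : i < m) : a i = a' i := by
  classical
  have key : ∀ x, (∃ i < m, a i = x) ↔ ∃ i < m, a' i = x := by
    intro x
    have h1 := h.above le_rfl x
    have h2 := h'.above le_rfl x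
    rw [h0, hm] at h1
    by_cases c1 : ∃ i < m, a i = x <;> by_cases c2 : ∃ i < m, a' i = x
    · exact iff_of_true c1 c2
    · rw [if_pos c1] at h1
      rw [if_neg c2] at h2
      omega
    · rw [if_neg c1] at h1
      rw [if_pos c2] at h2
      omega
    · exact iff_of_false c1 c2
  induction i using Nat.strong_induction_on with
  | _ i ih =>
    obtain ⟨k, hk, e1⟩ := (key (a i)).mp ⟨i, hi, rfl⟩
    obtain ⟨l, hl, e2⟩ := (key (a' i)).mpr ⟨i, hi, rfl⟩
    have h1 : i ≤ k := by
      by_contra! hki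
      have := ih k hki hk
      have := h.lt hki hi
      omega
    have h2 : i ≤ l := by
      by_contra! hli
      have := ih l hli hl
      have := h'.lt hli hi
      omega
    have h3 := h'.lt_iff hk hi
    have h4 := h.lt_iff hl hi
    omega

end IsPath

/-! ### Uniqueness of the admissible function -/

namespace IsAdmissible

open Grid

variable {N m n : ℕ} {mu rho lam nu : Sig N} {G G' : Grid N}

theorem v_le_v (hG : IsAdmissible m n mu rho lam nu G) {i k j : ℕ} (hik : i ≤ k) (hk : k ≤ m)
    (hj : j < n) : G.v i j ≤ G.v k j := by
  induction k, hik using Nat.le_induction with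
  | base => rfl
  | succ k _ ih =>
    have h1 := ih (by omega)
    have h2 := hG.box_trichotomy (i := k) (j := j) hk hj
    omega

/-- To the right of a zero-box all boxes are trivial, so the vertical label does not change. -/
theorem v_eq_of_isZero (hG : IsAdmissible m n mu rho lam nu G) {i k j : ℕ} (hj : j < n)
    (h : G.IsZero i j) (hik : i < k) (hk : k ≤ m) : G.v k j = G.h i j := by
  induction k, hik using Nat.le_induction with
  | base => exact h.2.2
  | succ k hik ih =>
    have h1 := ih (by omega)
    have h2 := hG.box_trichotomy (i := k) (j := j) hk hj
    have h3 := (hG.row hj.le).lt hik hk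
    omega

/-- An admissible function is determined by its corners. The labels on three sides of the rectangle
are read off from the corners; then the labels of each row of boxes are found from left to right,
and the label on the right end tells a zero-box from a one-box. -/
theorem labels_unique (hG : IsAdmissible m n mu rho lam nu G)
    (hG' : IsAdmissible m n mu rho lam nu G') :
    (∀ i j, i < m → j ≤ n → G.h i j = G'.h i j) ∧
      ∀ i j, i ≤ m → j < n → G.v i j = G'.v i j := by
  have strip : ∀ j, j < n → (∀ i < m, G.h i j = G'.h i j) →
      ∀ i, (i ≤ m → G.v i j = G'.v i j) ∧ (i < m → G.h i (j + 1) = G'.h i (j + 1)) := by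
    intro j hj hh i
    have left : G.v 0 j = G'.v 0 j :=
      (hG.column (Nat.zero_le m)).label_unique (hG'.column (Nat.zero_le m))
        (hG.sw.trans hG'.sw.symm) (hG.nw.trans hG'.nw.symm) hj
    have right : G.v m j = G'.v m j :=
      (hG.column le_rfl).label_unique (hG'.column le_rfl)
        (hG.se.trans hG'.se.symm) (hG.ne.trans hG'.ne.symm) hj
    -- The label `v m j` on the right decides between a zero-box and a one-box.
    have step : ∀ i < m, G.v i j = G'.v i j →
        G.v (i + 1) j = G'.v (i + 1) j ∧ G.h i (j + 1) = G'.h i (j + 1) := by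
      intro i hi hv
      have e := hh i hi
      rcases hG.isTrivial_or hi hj with h1 | h1 | h1 <;>
        rcases hG'.isTrivial_or hi hj with h2 | h2 | h2
      · have a1 := h1.1; have a2 := h1.2.2; have a3 := h2.1; have a4 := h2.2.2
        omega
      · exact absurd (e.trans (h2.1.trans hv.symm)) h1.2.1
      · exact absurd (e.trans (h2.1.trans hv.symm)) h1.2.1
      · exact absurd (e.symm.trans (h1.1.trans hv)) h2.2.1
      · have a1 := h1.2; have a2 := h2.2
        omega
      · have a1 := hG.v_eq_of_isZero hj h1 hi le_rfl
        have a2 := hG'.v_le_v (i := i + 1) hi le_rfl hj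
        have a3 := h2.2.2
        omega
      · exact absurd (e.symm.trans (h1.1.trans hv)) h2.2.1
      · have a1 := hG'.v_eq_of_isZero hj h2 hi le_rfl
        have a2 := hG.v_le_v (i := i + 1) hi le_rfl hj
        have a3 := h1.2.2
        omega
      · have a1 := h1.2; have a2 := h2.2
        omega
    have hv : ∀ i ≤ m, G.v i j = G'.v i j := by
      intro i
      induction i with
      | zero => exact fun _ => left
      | succ i ih => exact fun hi => (step i hi (ih (by omega))).1
    exact ⟨hv i, fun hi => (step i hi (hv i hi.le)).2⟩
  have hh : ∀ j ≤ n, ∀ i < m, G.h i j = G'.h i j := by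
    intro j
    induction j with
    | zero =>
      intro _ i hi
      exact (hG.row (Nat.zero_le n)).label_unique (hG'.row (Nat.zero_le n))
        (hG.sw.trans hG'.sw.symm) (hG.se.trans hG'.se.symm) hi
    | succ j ih => exact fun hj i hi => (strip j hj (ih (by omega)) i).2 hi
  exact ⟨fun i j hi hj => hh j hj i hi, fun i j hi hj => (strip j hj (hh j hj.le) i).1 hi⟩

theorem mult_unique (hG : IsAdmissible m n mu rho lam nu G)
    (hG' : IsAdmissible m n mu rho lam nu G') {i j : ℕ} (hi : i ≤ m) (hj : j ≤ n) (x : ℤ) :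
    G.mult i j x = G'.mult i j x := by
  obtain ⟨hh, hv⟩ := hG.labels_unique hG'
  induction i with
  | zero =>
    induction j with
    | zero => rw [mult, mult, hG.sw, hG'.sw]
    | succ j ih =>
      have h1 := hG.mult_v hi hj x
      have h2 := hG'.mult_v hi hj x
      rw [← hv 0 j hi hj, ← ih (by omega)] at h2
      omega
  | succ i ih =>
    have h1 := hG.mult_h hi hj x
    have h2 := hG'.mult_h hi hj x
    rw [← hh i j hi hj, ← ih (by omega)] at h2
    omega

theorem swWeight_unique (hG : IsAdmissible m n mu rho lam nu G)
    (hG' : IsAdmissible m n mu rho lam nu G') (s t : ℝ) {i j : ℕ} (hi : i < m) (hj : j < n) :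
    G.swWeight s t m n i j = G'.swWeight s t m n i j := by
  classical
  obtain ⟨hh, hv⟩ := hG.labels_unique hG'
  have hz : ∀ i j, i < m → j < n → (G.IsZero i j ↔ G'.IsZero i j) := by
    intro i j hi hj
    simp only [IsZero, hh i j hi hj.le, hh i (j + 1) hi hj, hv i j hi.le hj, hv (i + 1) j hi hj]
  have ho : ∀ i j, i < m → j < n → (G.IsOne i j ↔ G'.IsOne i j) := by
    intro i j hi hj
    simp only [IsOne, hh i j hi hj.le, hh i (j + 1) hi hj, hv i j hi.le hj, hv (i + 1) j hi hj]
  have hH : G.HConsec m i j ↔ G'.HConsec m i j := by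
    simp only [HConsec, hh i j hi hj.le, hh (i - 1) j (by omega) hj.le]
  have hV : G.VConsec n i j ↔ G'.VConsec n i j := by
    simp only [VConsec, hv i j hi.le hj, hv i (j - 1) hi.le (by omega)]
  have hl : G.LeftOne i j ↔ G'.LeftOne i j := and_congr_right fun _ => ho _ j (by omega) hj
  have hb : G.BelowOne i j ↔ G'.BelowOne i j := and_congr_right fun _ => ho i _ hi (by omega)
  simp only [swWeight, hl, hb, hz i j hi hj, ho i j hi hj, hH, hV,
    hz (i - 1) (j - 1) (by omega) (by omega), ho (i - 1) (j - 1) (by omega) (by omega),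
    hh i j hi hj.le, hG.mult_unique hG' hi.le hj.le]

/-! ### The weight in terms of consecutive labels -/

/-- The cases in the definition of the weight are distinguished by consecutive labels, as the
previous label is at most `r - 1`. -/
theorem hPrev_eq_iff (hG : IsAdmissible m n mu rho lam nu G) {i j : ℕ} (hi : i < m) (hj : j < n) :
    (G.hPrev i j = ((G.r i j - 1 : ℤ) : WithBot ℤ) ↔ G.HConsec m i j) ∧
      (G.hPrev i j < ((G.r i j - 1 : ℤ) : WithBot ℤ) ↔ ¬ G.HConsec m i j) := by
  obtain _ | i := i
  · simp [hPrev, HConsec, WithBot.bot_lt_coe]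
  · have := hG.h_lt' (i := i) (j := j) hi hj.le
    simp only [hPrev, HConsec, r, Nat.add_sub_cancel, Nat.succ_ne_zero, if_false, WithBot.coe_inj,
      WithBot.coe_lt_coe]
    omega

theorem vPrev_eq_iff (hG : IsAdmissible m n mu rho lam nu G) {i j : ℕ} (hi : i < m) (hj : j < n)
    (h : G.h i j = G.v i j) :
    (G.vPrev i j = ((G.r i j - 1 : ℤ) : WithBot ℤ) ↔ G.VConsec n i j) ∧
      (G.vPrev i j < ((G.r i j - 1 : ℤ) : WithBot ℤ) ↔ ¬ G.VConsec n i j) := by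
  obtain _ | j := j
  · simp [vPrev, VConsec, WithBot.bot_lt_coe]
  · have := hG.v_lt' (i := i) (j := j) hi.le hj
    simp only [vPrev, VConsec, r, Nat.add_sub_cancel, Nat.succ_ne_zero, if_false, WithBot.coe_inj,
      WithBot.coe_lt_coe]
    omega

theorem isTrivial_left_iff (hG : IsAdmissible m n mu rho lam nu G) {i j : ℕ} (hi : i < m)
    (hj : j < n) (h : G.h i j = G.v i j) :
    (i = 0 ∨ G.IsTrivial (i - 1) j) ↔ ¬ G.LeftOne i j := by
  obtain _ | i := i
  · simp [LeftOne]
  · have h1 := hG.not_isZero_left hi hj h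
    have h2 := hG.isTrivial_or (i := i) (j := j) (by omega) hj
    have h3 : G.IsTrivial i j → ¬ G.IsOne i j := fun h => h.not_isOne
    simp only [LeftOne, Nat.add_sub_cancel, Nat.succ_ne_zero, false_or, Nat.le_add_left, true_and]
    tauto

theorem isTrivial_below_iff (hG : IsAdmissible m n mu rho lam nu G) {i j : ℕ} (hi : i < m)
    (hj : j < n) (h : G.h i j = G.v i j) :
    (j = 0 ∨ G.IsTrivial i (j - 1)) ↔ ¬ G.BelowOne i j := by
  obtain _ | j := j
  · simp [BelowOne]
  · have h1 := hG.not_isZero_below hi hj h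
    have h2 := hG.isTrivial_or (i := i) (j := j) hi (by omega)
    have h3 : G.IsTrivial i j → ¬ G.IsOne i j := fun h => h.not_isOne
    simp only [BelowOne, Nat.add_sub_cancel, Nat.succ_ne_zero, false_or, Nat.le_add_left, true_and]
    tauto

/-- A nontrivial box diagonally below a nontrivial box with `r̄ = r - 1` touches it in a linked
vertex. -/
theorem linked_of_diag {i j : ℕ} (hi : i < m)
    (hj : j < n) (h : G.h i j = G.v i j) (h1 : 1 ≤ i) (h2 : 1 ≤ j)
    (hd : G.IsZero (i - 1) (j - 1) ∨ G.IsOne (i - 1) (j - 1))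
    (hr : G.rBar (i - 1) (j - 1) = G.r i j - 1) : G.HConsec m i j ∧ G.VConsec n i j := by
  obtain ⟨i, rfl⟩ := Nat.exists_eq_add_of_le' h1
  obtain ⟨j, rfl⟩ := Nat.exists_eq_add_of_le' h2
  simp only [Nat.add_sub_cancel, rBar, r, IsZero, IsOne, HConsec, VConsec] at *
  omega

theorem rBar_of_linked {i j : ℕ} (hH : G.HConsec m i j) (hV : G.VConsec n i j) :
    1 ≤ i ∧ 1 ≤ j ∧ G.rBar (i - 1) (j - 1) = G.r i j - 1 := by
  obtain ⟨i, rfl⟩ := Nat.exists_eq_add_of_le' hH.1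
  obtain ⟨j, rfl⟩ := Nat.exists_eq_add_of_le' hV.1
  have := hH.2.2
  simp only [Nat.add_sub_cancel, rBar, r] at *
  omega

/-- The weight is `swWeight` with `s = t`. For a zero-box without consecutive labels,
`t (1 - t ^ (d - 1)) = t - c` with `c = t ^ d`. -/
theorem weight_eq_swWeight (hG : IsAdmissible m n mu rho lam nu G) (t : ℝ) {i j : ℕ}
    (hi : i < m) (hj : j < n) : G.weight t i j = G.swWeight t t m n i j := by
  classical
  rcases hG.isTrivial_or hi hj with h | h | h
  · rw [weight, if_pos h, swWeight, if_neg h.not_isZero, if_neg h.not_isOne]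
  · have ht : ¬ G.IsTrivial i j := fun h' => h'.2.1 h.1
    have ho := h.not_isOne
    obtain ⟨a1, a2⟩ := hG.hPrev_eq_iff hi hj
    obtain ⟨b1, b2⟩ := hG.vPrev_eq_iff hi hj h.1
    have hd : (1 ≤ i ∧ 1 ≤ j ∧ G.IsZero (i - 1) (j - 1) ∧
        G.rBar (i - 1) (j - 1) = G.r i j - 1) ↔
        (G.HConsec m i j ∧ G.VConsec n i j) ∧ G.IsZero (i - 1) (j - 1) := by
      constructor
      · rintro ⟨h1, h2, h3, h4⟩
        exact ⟨linked_of_diag hi hj h.1 h1 h2 (Or.inl h3) h4, h3⟩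
      · rintro ⟨⟨h1, h2⟩, h3⟩
        obtain ⟨h4, h5, h6⟩ := rBar_of_linked h1 h2
        exact ⟨h4, h5, h3, h6⟩
    unfold weight swWeight
    rw [if_neg ht, if_pos h]
    simp only [ho, false_and, if_false, h, true_and, hd, a1, a2, b1, b2]
    by_cases hH : G.HConsec m i j <;> by_cases hV : G.VConsec n i j
    · simp [hH, hV, Xor]
    · simp [hH, hV, Xor]
    · simp [hH, hV, Xor]
    · have hc : G.c t i j = t ^ (G.mult i j (G.h i j) - 1) * t := by
        rw [c, ← pow_succ]
        have := hG.mult_h_pos hi hj.le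
        congr 1
        unfold mult at this ⊢
        unfold r
        omega
      have hc' : G.c t i j = t ^ G.mult i j (G.h i j) := rfl
      simp only [hH, hV, Xor, false_and, or_false, if_false, not_false_eq_true,
        and_self, if_true]
      rw [← hc', ← mul_div_assoc]
      nth_rewrite 1 [hc]
      ring
  · have ht : ¬ G.IsTrivial i j := fun h' => h'.2.1 h.1
    have hz := h.not_isZero
    obtain ⟨a1, a2⟩ := hG.hPrev_eq_iff hi hj
    obtain ⟨b1, b2⟩ := hG.vPrev_eq_iff hi hj h.1
    have c1 := hG.isTrivial_left_iff hi hj h.1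
    have c2 := hG.isTrivial_below_iff hi hj h.1
    have d1 := G.hConsec_of_leftOne hi h.1
    have d2 := G.vConsec_of_belowOne hj h.1
    have hd : (1 ≤ i ∧ 1 ≤ j ∧ G.IsOne (i - 1) (j - 1) ∧
        G.rBar (i - 1) (j - 1) = G.r i j - 1) ↔
        (G.HConsec m i j ∧ G.VConsec n i j) ∧ G.IsOne (i - 1) (j - 1) := by
      constructor
      · rintro ⟨h1, h2, h3, h4⟩
        exact ⟨linked_of_diag hi hj h.1 h1 h2 (Or.inr h3) h4, h3⟩
      · rintro ⟨⟨h1, h2⟩, h3⟩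
        obtain ⟨h4, h5, h6⟩ := rBar_of_linked h1 h2
        exact ⟨h4, h5, h3, h6⟩
    have e1 : G.HConsec m i j → G.VConsec n i j → (G.LeftOne i j ∨ G.BelowOne i j) →
        G.IsOne (i - 1) (j - 1) := by
      intro hH hV
      have hL : G.Linked m n i j := ⟨hH, hV, h.1⟩
      obtain ⟨i, rfl⟩ := Nat.exists_eq_add_of_le' hH.1
      obtain ⟨j, rfl⟩ := Nat.exists_eq_add_of_le' hV.1
      rintro (hl | hb)
      · exact hG.isOne_diag_of_leftOne hi hj hL hl.2
      · exact hG.isOne_diag_of_belowOne hi hj hL hb.2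
    unfold weight swWeight
    rw [if_neg ht, if_neg hz, if_pos h]
    have l1 : (1 ≤ i ∧ G.IsOne (i - 1) j) = G.LeftOne i j := rfl
    have l2 : (1 ≤ j ∧ G.IsOne i (j - 1)) = G.BelowOne i j := rfl
    simp only [hz, false_and, if_false, h, true_and, hd, a1, a2, b1, b2, c1, c2, l1, l2]
    have hc' : G.c t i j = t ^ G.mult i j (G.h i j) := rfl
    rw [hc']
    by_cases hH : G.HConsec m i j <;> by_cases hV : G.VConsec n i j <;>
      by_cases hl : G.LeftOne i j <;> by_cases hb : G.BelowOne i j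
    all_goals
      first
      | exact absurd (d1 hl) hH
      | exact absurd (d2 hb) hV
      | simp only [hH, hV, hl, hb, Xor, or_true, or_self, and_true, true_and, if_true,
          if_false, not_true_eq_false, not_false_eq_true, and_false, false_and, or_false,
          and_self, mul_one, div_eq_mul_inv]
    all_goals rw [if_pos (e1 hH hV (by simp [hl, hb]))]

end IsAdmissible

/-- `U` can be computed with any admissible function. -/
theorem U_eq_prod (t : ℝ) {N : ℕ} {mu rho lam nu : Sig N}
    (h : Interlace lam nu ∧ Interlace lam mu ∧ Interlace nu rho ∧ Interlace mu rho ∧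
      nu.size - lam.size = rho.size - mu.size) {m n : ℕ} (hm : (nu.size - lam.size).toNat = m)
    (hn : (mu.size - lam.size).toNat = n) {G : Grid N} (hG : IsAdmissible m n mu rho lam nu G) :
    U t mu rho lam nu =
      ∏ i ∈ Finset.range m, ∏ j ∈ Finset.range n, G.swWeight t t m n i j := by
  subst hm hn
  have hex : ∃ G : Grid N, IsAdmissible (nu.size - lam.size).toNat (mu.size - lam.size).toNat
    mu rho lam nu G := ⟨G, hG⟩
  rw [U, dif_pos ⟨h, hex⟩]
  refine Finset.prod_congr rfl fun i hi => Finset.prod_congr rfl fun j hj => ?_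
  rw [Finset.mem_range] at hi hj
  rw [hex.choose_spec.weight_eq_swWeight t hi hj, hex.choose_spec.swWeight_unique hG t t hi hj]

/-! ### The flipped admissible function -/

namespace Grid

variable {N : ℕ}

/-- The function `(i, j) ↦ -Λ(m - i, n - j)` with the labels of its edges. -/
def flip (G : Grid N) (m n : ℕ) : Grid N where
  val i j := (G.val (m - i) (n - j)).neg
  h i j := -G.h (m - 1 - i) (n - j) - 1
  v i j := -G.v (m - i) (n - 1 - j) - 1

variable {G : Grid N} {m n i j : ℕ}

theorem flip_sw (hi : i < m) (hj : j < n) :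
    (G.flip m n).h (m - 1 - i) (n - 1 - j) = -G.h i (j + 1) - 1 ∧
    (G.flip m n).v (m - 1 - i) (n - 1 - j) = -G.v (i + 1) j - 1 := by
  have h1 : m - 1 - (m - 1 - i) = i := by omega
  have h2 : n - (n - 1 - j) = j + 1 := by omega
  have h3 : m - (m - 1 - i) = i + 1 := by omega
  have h4 : n - 1 - (n - 1 - j) = j := by omega
  simp only [flip, h1, h2, h3, h4, and_self]

theorem flip_ne (hi : i < m) (hj : j < n) :
    (G.flip m n).h (m - 1 - i) (n - 1 - j + 1) = -G.h i j - 1 ∧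
    (G.flip m n).v (m - 1 - i + 1) (n - 1 - j) = -G.v i j - 1 := by
  have h1 : m - 1 - (m - 1 - i) = i := by omega
  have h2 : n - (n - 1 - j + 1) = j := by omega
  have h3 : m - (m - 1 - i + 1) = i := by omega
  have h4 : n - 1 - (n - 1 - j) = j := by omega
  simp only [flip, h1, h2, h3, h4, and_self]

theorem flip_isZero (hi : i < m) (hj : j < n) :
    (G.flip m n).IsZero (m - 1 - i) (n - 1 - j) ↔ G.IsZero i j := by
  unfold IsZero
  rw [(flip_sw hi hj).1, (flip_sw hi hj).2, (flip_ne hi hj).1, (flip_ne hi hj).2]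
  omega

theorem flip_isOne (hi : i < m) (hj : j < n) :
    (G.flip m n).IsOne (m - 1 - i) (n - 1 - j) ↔ G.IsOne i j := by
  unfold IsOne
  rw [(flip_sw hi hj).1, (flip_sw hi hj).2, (flip_ne hi hj).1, (flip_ne hi hj).2]
  omega

theorem flip_hConsec (hi : i < m) (hj : j < n) :
    (G.flip m n).HConsec m (m - 1 - i) (n - 1 - j) ↔ G.HConsec m (i + 1) (j + 1) := by
  unfold HConsec
  rw [(flip_sw hi hj).1, Nat.add_sub_cancel]
  by_cases hi' : i + 1 < m
  · have h1 : m - 1 - i - 1 = m - 1 - (i + 1) := by omega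
    rw [h1, (flip_sw hi' hj).1]
    omega
  · omega

theorem flip_vConsec (hi : i < m) (hj : j < n) :
    (G.flip m n).VConsec n (m - 1 - i) (n - 1 - j) ↔ G.VConsec n (i + 1) (j + 1) := by
  unfold VConsec
  rw [(flip_sw hi hj).2, Nat.add_sub_cancel]
  by_cases hj' : j + 1 < n
  · have h1 : n - 1 - j - 1 = n - 1 - (j + 1) := by omega
    rw [h1, (flip_sw hi hj').2]
    omega
  · omega

theorem flip_leftOne (hi : i < m) (hj : j < n) :
    (G.flip m n).LeftOne (m - 1 - i) (n - 1 - j) ↔ G.RightOne m i j := by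
  unfold LeftOne RightOne
  by_cases hi' : i + 1 < m
  · have h1 : m - 1 - i - 1 = m - 1 - (i + 1) := by omega
    rw [h1, flip_isOne hi' hj]
    exact and_congr_left fun _ => by omega
  · exact iff_of_false (fun h => by have := h.1; omega) (fun h => hi' h.1)

theorem flip_belowOne (hi : i < m) (hj : j < n) :
    (G.flip m n).BelowOne (m - 1 - i) (n - 1 - j) ↔ G.AboveOne n i j := by
  unfold BelowOne AboveOne
  by_cases hj' : j + 1 < n
  · have h1 : n - 1 - j - 1 = n - 1 - (j + 1) := by omega
    rw [h1, flip_isOne hi hj']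
    exact and_congr_left fun _ => by omega
  · exact iff_of_false (fun h => by have := h.1; omega) (fun h => hj' h.1)

theorem flip_swWeight (s t : ℝ) (hi : i < m) (hj : j < n) :
    (G.flip m n).swWeight s t m n (m - 1 - i) (n - 1 - j) = G.neWeight s t m n i j := by
  classical
  have hm : (G.flip m n).mult (m - 1 - i) (n - 1 - j)
      ((G.flip m n).h (m - 1 - i) (n - 1 - j)) = G.mult (i + 1) (j + 1) (G.h i (j + 1) + 1) := by
    have h2 : n - (n - 1 - j) = j + 1 := by omega
    have h3 : m - (m - 1 - i) = i + 1 := by omega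
    rw [(flip_sw hi hj).1, mult, flip]
    dsimp only
    rw [Sig.count_neg, h2, h3, mult]
    congr 1
    ring
  unfold swWeight neWeight
  rw [hm]
  simp only [flip_isZero hi hj, flip_isOne hi hj, flip_hConsec hi hj, flip_vConsec hi hj,
    flip_leftOne hi hj, flip_belowOne hi hj]
  by_cases hHV : G.HConsec m (i + 1) (j + 1) ∧ G.VConsec n (i + 1) (j + 1)
  · have h1 : m - 1 - i - 1 = m - 1 - (i + 1) := by omega
    have h2 : n - 1 - j - 1 = n - 1 - (j + 1) := by omega
    rw [h1, h2]
    simp only [flip_isZero hHV.1.2.1 hHV.2.2.1, flip_isOne hHV.1.2.1 hHV.2.2.1]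
  · simp only [if_neg hHV]

theorem prod_flip_swWeight (s t : ℝ) :
    ∏ i ∈ Finset.range m, ∏ j ∈ Finset.range n, (G.flip m n).swWeight s t m n i j =
      ∏ i ∈ Finset.range m, ∏ j ∈ Finset.range n, G.neWeight s t m n i j := by
  rw [← Finset.prod_range_reflect]
  refine Finset.prod_congr rfl fun i hi => ?_
  rw [← Finset.prod_range_reflect]
  exact Finset.prod_congr rfl fun j hj =>
    flip_swWeight s t (Finset.mem_range.mp hi) (Finset.mem_range.mp hj)

end Grid

theorem IsAdmissible.flip {N m n : ℕ} {mu rho lam nu : Sig N} {G : Grid N}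
    (hG : IsAdmissible m n mu rho lam nu G) :
    IsAdmissible m n nu.neg lam.neg rho.neg mu.neg (G.flip m n) where
  sw := by simp [Grid.flip, hG.ne]
  se := by simp [Grid.flip, hG.nw]
  nw := by simp [Grid.flip, hG.se]
  ne := by simp [Grid.flip, hG.sw]
  move_h i j hi hj := by
    have h1 := (hG.move_h (m - 1 - i) (n - j) (by omega) (by omega)).neg
    have h2 : m - 1 - i + 1 = m - i := by omega
    have h3 : m - 1 - i = m - (i + 1) := by omega
    rw [h2] at h1
    simpa only [Grid.flip, ← h3] using h1
  move_v i j hi hj := by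
    have h1 := (hG.move_v (m - i) (n - 1 - j) (by omega) (by omega)).neg
    have h2 : n - 1 - j + 1 = n - j := by omega
    have h3 : n - 1 - j = n - (j + 1) := by omega
    rw [h2] at h1
    simpa only [Grid.flip, ← h3] using h1
  h_lt i j hi hj := by
    have h1 := hG.h_lt (m - 1 - (i + 1)) (n - j) (by omega) (by omega)
    have h2 : m - 1 - (i + 1) + 1 = m - 1 - i := by omega
    rw [h2] at h1
    simp only [Grid.flip]
    omega
  v_lt i j hi hj := by
    have h1 := hG.v_lt (m - i) (n - 1 - (j + 1)) (by omega) (by omega)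
    have h2 : n - 1 - (j + 1) + 1 = n - 1 - j := by omega
    rw [h2] at h1
    simp only [Grid.flip]
    omega
  box i j hi hj h := by
    obtain ⟨i, rfl, hi'⟩ : ∃ k, i = m - 1 - k ∧ k < m := ⟨m - 1 - i, by omega, by omega⟩
    obtain ⟨j, rfl, hj'⟩ : ∃ k, j = n - 1 - k ∧ k < n := ⟨n - 1 - j, by omega, by omega⟩
    have h1 := hG.box_trichotomy hi' hj'
    rw [(Grid.flip_sw hi' hj').1, (Grid.flip_sw hi' hj').2] at h
    rw [(Grid.flip_sw hi' hj').1, (Grid.flip_ne hi' hj').1, (Grid.flip_ne hi' hj').2]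
    omega

/-! ### The flip property for signatures -/

namespace IsAdmissible

open Grid

variable {N m n : ℕ} {mu rho lam nu : Sig N} {G : Grid N}

theorem phi_eq_prod_hGauge (hG : IsAdmissible m n mu rho lam nu G) (t : ℝ) {j : ℕ}
    (hj : j = 0 ∨ j = n) (hI : Interlace (G.val 0 j) (G.val m j)) :
    phi t (G.val m j) (G.val 0 j) = ∏ i ∈ Finset.range m, G.hGauge t m n i j := by
  classical
  rw [(hG.row (by omega)).phi_eq t hI]
  refine Finset.prod_congr rfl fun i _ => ?_
  have h1 : ¬ G.VConsec n (i + 1) j := fun h => by have := h.1; have := h.2.1; omega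
  have h2 : ¬ (G.BelowOne i j ∧ j < n ∧ G.IsOne i j) := fun h => by
    have := h.1.1
    have := h.2.1
    omega
  have h3 : G.HConsec m (i + 1) j ↔ i + 1 < m ∧ G.h i j + 1 = G.h (i + 1) j := by
    simp [HConsec]
  simp only [hGauge, h1, h2, h3, false_and, and_false, not_false_eq_true, and_true, if_false,
    mul_one, mult, ite_not]

theorem psi_eq_prod_vGauge (hG : IsAdmissible m n mu rho lam nu G) (t : ℝ) {i : ℕ}
    (hi : i = 0 ∨ i = m) (hI : Interlace (G.val i 0) (G.val i n)) :
    psi t (G.val i n) (G.val i 0) = ∏ j ∈ Finset.range n, G.vGauge t m n i j := by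
  classical
  rw [(hG.column (by omega)).psi_eq t hI]
  refine Finset.prod_congr rfl fun j hj => ?_
  have h1 : ¬ G.HConsec m i j := fun h => by have := h.1; have := h.2.1; omega
  have h2 : ¬ (G.LeftOne i j ∧ i < m ∧ G.IsOne i j) := fun h => by
    have := h.1.1
    have := h.2.1
    omega
  have h3 : G.VConsec n i j ↔ 1 ≤ j ∧ G.v i (j - 1) + 1 = G.v i j := by
    simp [VConsec, Finset.mem_range.mp hj]
  simp only [vGauge, h1, h2, h3, false_and, and_false, not_false_eq_true, and_true, if_false,
    mul_one, mult, ite_not]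

end IsAdmissible

/-- The condition for `U` to be given by an admissible function is invariant under the flip. -/
theorem U_flip_cond {N : ℕ} {mu rho lam nu : Sig N}
    (h : (Interlace lam nu ∧ Interlace lam mu ∧ Interlace nu rho ∧ Interlace mu rho ∧
      nu.size - lam.size = rho.size - mu.size) ∧
      ∃ G : Grid N, IsAdmissible (nu.size - lam.size).toNat (mu.size - lam.size).toNat
        mu rho lam nu G) :
    (Interlace rho.neg mu.neg ∧ Interlace rho.neg nu.neg ∧ Interlace mu.neg lam.neg ∧
      Interlace nu.neg lam.neg ∧ mu.neg.size - rho.neg.size = lam.neg.size - nu.neg.size) ∧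
      ∃ G : Grid N, IsAdmissible (mu.neg.size - rho.neg.size).toNat
        (nu.neg.size - rho.neg.size).toNat nu.neg lam.neg rho.neg mu.neg G := by
  obtain ⟨⟨h1, h2, h3, h4, h5⟩, G, hG⟩ := h
  simp only [Sig.size_neg]
  refine ⟨⟨h4.neg, h3.neg, h2.neg, h1.neg, by omega⟩, ?_⟩
  have e1 : -mu.size - -rho.size = nu.size - lam.size := by omega
  have e2 : -nu.size - -rho.size = mu.size - lam.size := by omega
  rw [e1, e2]
  exact ⟨_, hG.flip⟩

/-- The flip property for signatures, without denominators. -/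
theorem U_mul_flip {t : ℝ} (ht0 : 0 ≤ t) (ht1 : t < 1) {N : ℕ} (mu rho lam nu : Sig N) :
    U t mu rho lam nu * (phi t nu lam * psi t mu lam) =
      U t nu.neg lam.neg rho.neg mu.neg * (phi t rho mu * psi t rho nu) := by
  by_cases h : (Interlace lam nu ∧ Interlace lam mu ∧ Interlace nu rho ∧ Interlace mu rho ∧
      nu.size - lam.size = rho.size - mu.size) ∧
      ∃ G : Grid N, IsAdmissible (nu.size - lam.size).toNat (mu.size - lam.size).toNat
        mu rho lam nu G
  · have h' := U_flip_cond h
    obtain ⟨hI, G, hG⟩ := h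
    have e1 : (mu.neg.size - rho.neg.size).toNat = (nu.size - lam.size).toNat := by
      simp only [Sig.size_neg]
      omega
    have e2 : (nu.neg.size - rho.neg.size).toNat = (mu.size - lam.size).toNat := by
      simp only [Sig.size_neg]
      omega
    rw [U_eq_prod t hI rfl rfl hG, U_eq_prod t h'.1 e1 e2 hG.flip, Grid.prod_flip_swWeight]
    have f1 := hG.phi_eq_prod_hGauge t (j := 0) (Or.inl rfl)
    have f2 := hG.phi_eq_prod_hGauge t (Or.inr rfl)
    have f3 := hG.psi_eq_prod_vGauge t (i := 0) (Or.inl rfl)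
    have f4 := hG.psi_eq_prod_vGauge t (Or.inr rfl)
    rw [hG.sw, hG.se] at f1
    rw [hG.nw, hG.ne] at f2
    rw [hG.sw, hG.nw] at f3
    rw [hG.se, hG.ne] at f4
    rw [f1 hI.1, f2 hI.2.2.2.1, f3 hI.2.1, f4 hI.2.2.1]
    exact hG.prod_swWeight_mul ht0 ht1
  · have h' : ¬ ((Interlace rho.neg mu.neg ∧ Interlace rho.neg nu.neg ∧ Interlace mu.neg lam.neg ∧
        Interlace nu.neg lam.neg ∧ mu.neg.size - rho.neg.size = lam.neg.size - nu.neg.size) ∧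
        ∃ G : Grid N, IsAdmissible (mu.neg.size - rho.neg.size).toNat
          (nu.neg.size - rho.neg.size).toNat nu.neg lam.neg rho.neg mu.neg G) := by
      intro h'
      have := U_flip_cond h'
      simp only [Sig.neg_neg] at this
      exact h this
    rw [U, U, dif_neg h, dif_neg h', zero_mul, zero_mul]

/-! ### Young diagrams and signatures with an additional part -/

namespace Sig

variable {N : ℕ}

theorem append_ext_of_le (lam : Sig N) {c : ℤ} (hc : ∀ i, c ≤ lam.part i) {k : ℕ} (hk : k ≤ N) :
    (lam.append c hc).ext k = lam.ext k := by
  rcases Nat.eq_zero_or_pos k with rfl | hk1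
  · rfl
  · obtain ⟨i, rfl⟩ := exists_fin hk1 hk
    rw [lam.ext_succ]
    have := (lam.append c hc).ext_succ i.castSucc
    rw [Fin.val_castSucc] at this
    rw [this]
    simp [append]

theorem append_ext_last (lam : Sig N) {c : ℤ} (hc : ∀ i, c ≤ lam.part i) :
    (lam.append c hc).ext (N + 1) = ((c : ℤ) : WithTop ℤ) := by
  have := (lam.append c hc).ext_succ (Fin.last N)
  rw [Fin.val_last] at this
  rw [this]
  simp [append]

theorem coe_le_ext (lam : Sig N) {c : ℤ} (hc : ∀ i, c ≤ lam.part i) {k : ℕ} (hk : k ≤ N) :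
    (((c : ℤ) : WithTop ℤ) : ExtInt) ≤ lam.ext k := by
  rcases Nat.eq_zero_or_pos k with rfl | hk1
  · rw [ext_zero]
    exact le_top
  · obtain ⟨i, rfl⟩ := exists_fin hk1 hk
    rw [lam.ext_succ, coe_le_coe_ext]
    exact hc i

theorem coe_lt_ext (lam : Sig N) {c : ℤ} (hc : ∀ i, c < lam.part i) {k : ℕ} (hk : k ≤ N) :
    (((c : ℤ) : WithTop ℤ) : ExtInt) < lam.ext k := by
  rcases Nat.eq_zero_or_pos k with rfl | hk1
  · rw [ext_zero]
    exact WithBot.coe_lt_coe.mpr (WithTop.coe_lt_top _)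
  · obtain ⟨i, rfl⟩ := exists_fin hk1 hk
    rw [lam.ext_succ, coe_lt_coe_ext]
    exact hc i

end Sig

theorem Interlace.append_left {N : ℕ} {lam : Sig N} {mu : Sig (N + 1)} (h : Interlace lam mu)
    {c : ℤ} (hc : ∀ i, c ≤ lam.part i) (hc' : ∀ i, c ≤ mu.part i) :
    Interlace (lam.append c hc) mu := by
  intro k hk
  rcases lt_trichotomy k (N + 1) with hkN | rfl | hkN
  · rw [Sig.append_ext_of_le lam hc (by omega)]
    exact h k hk
  · rw [Sig.append_ext_last, Sig.ext_of_lt mu (k := N + 1 + 1) (by omega)]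
    exact ⟨Sig.coe_le_ext mu hc' le_rfl, bot_le⟩
  · rw [Sig.ext_of_lt _ hkN, Sig.ext_of_lt mu (k := k + 1) (by omega)]
    exact ⟨bot_le, le_rfl⟩

theorem Interlace.append {N : ℕ} {lam nu : Sig N} (h : Interlace lam nu)
    {c d : ℤ} (hcd : c ≤ d) (hc : ∀ i, c ≤ lam.part i) (hd : ∀ i, d ≤ nu.part i)
    (hd' : ∀ i, d ≤ lam.part i) : Interlace (lam.append c hc) (nu.append d hd) := by
  intro k hk
  rcases lt_trichotomy k (N + 1) with hkN | rfl | hkN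
  · rw [Sig.append_ext_of_le lam hc (by omega), Sig.append_ext_of_le nu hd (by omega)]
    refine ⟨(h k hk).1, ?_⟩
    rcases Nat.lt_or_ge k N with hkN' | hkN'
    · rw [Sig.append_ext_of_le nu hd (by omega)]
      exact (h k hk).2
    · obtain rfl : k = N := by omega
      rw [Sig.append_ext_last]
      exact Sig.coe_le_ext lam hd' le_rfl
  · rw [Sig.append_ext_last, Sig.append_ext_last, Sig.ext_of_lt _ (Nat.lt_succ_self _)]
    exact ⟨(Sig.coe_le_coe_ext _ _).mpr hcd, bot_le⟩
  · rw [Sig.ext_of_lt _ hkN, Sig.ext_of_lt _ hkN, Sig.ext_of_lt _ (by omega)]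
    exact ⟨le_rfl, le_rfl⟩

theorem youngExt_succ (lam : YoungDiagram) (k : ℕ) :
    youngExt lam (k + 1) = (((lam.rowLen k : ℕ) : ℤ) : WithTop ℤ) := rfl

theorem rowLen_eq_zero {lam : YoungDiagram} {k : ℕ} (h : lam.colLen 0 ≤ k) :
    lam.rowLen k = 0 := by
  by_contra hne
  have h1 : (k, 0) ∈ lam := YoungDiagram.mem_iff_lt_rowLen.mpr (Nat.pos_of_ne_zero hne)
  have h2 := YoungDiagram.mem_iff_lt_colLen.mp h1
  omega

theorem youngExt_of_lt {lam : YoungDiagram} {k : ℕ} (h : lam.colLen 0 < k) :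
    youngExt lam k = ((0 : ℤ) : WithTop ℤ) := by
  obtain ⟨k, rfl⟩ := Nat.exists_eq_add_of_le' (Nat.one_le_of_lt h)
  rw [youngExt_succ, rowLen_eq_zero (by omega)]
  rfl

theorem youngExt_nonneg (lam : YoungDiagram) (k : ℕ) :
    (((0 : ℤ) : WithTop ℤ) : ExtInt) ≤ youngExt lam k := by
  rcases k with _ | k
  · exact le_top
  · rw [youngExt_succ, Sig.coe_le_coe_ext]
    omega

theorem youngSig_ext (lam : YoungDiagram) {k N : ℕ} (hk : k ≤ N) :
    (youngSig lam N).ext k = youngExt lam k := by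
  rcases Nat.eq_zero_or_pos k with rfl | hk1
  · rfl
  · obtain ⟨i, rfl⟩ := Sig.exists_fin hk1 hk
    rw [Sig.ext_succ, youngExt_succ]
    rfl

theorem Interlace.young {lam mu : YoungDiagram} {N M : ℕ} (hNM : N ≤ M) (hMN : M ≤ N + 1)
    (hlam : lam.colLen 0 ≤ N) (hmu : mu.colLen 0 ≤ M)
    (h : Interlace (youngSig lam N) (youngSig mu M)) :
    SeqInterlace (youngExt lam) (youngExt mu) := by
  intro k hk
  rcases Nat.lt_or_ge N k with hkN | hkN
  · rw [youngExt_of_lt (lam := lam) (by omega), youngExt_of_lt (lam := mu) (k := k + 1) (by omega)]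
    exact ⟨youngExt_nonneg _ _, le_rfl⟩
  · have h1 := h k hk
    rw [youngSig_ext lam hkN, youngSig_ext mu (hkN.trans hNM)] at h1
    refine ⟨h1.1, ?_⟩
    rcases Nat.lt_or_ge M (k + 1) with hkM | hkM
    · rw [youngExt_of_lt (lam := mu) (by omega)]
      exact youngExt_nonneg _ _
    · rw [youngSig_ext mu hkM] at h1
      exact h1.2

open scoped Classical in
/-- In the definition of `φ` for Young diagrams the product may run over additional empty rows. -/
theorem phiYoung_eq (t : ℝ) {nu lam : YoungDiagram} {M : ℕ} (hM : nu.colLen 0 ≤ M)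
    (h : SeqInterlace (youngExt lam) (youngExt nu)) :
    phiYoung t nu lam = ∏ j ∈ Finset.Icc 1 M, ∏ k ∈ Finset.Icc 1 j,
      if youngExt lam j < youngExt nu j ∧ youngExt nu j = youngExt nu k ∧
        youngExt nu k < youngExt lam (k - 1) then 1 - t ^ (j - k + 1) else 1 := by
  rw [phiYoung, phiSeq, if_pos h]
  refine Finset.prod_subset (Finset.Icc_subset_Icc_right hM) fun j hj hj' => ?_
  simp only [Finset.mem_Icc, not_and, not_le] at hj hj'
  refine Finset.prod_eq_one fun k _ => if_neg fun hc => ?_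
  have := hc.1
  rw [youngExt_of_lt (lam := nu) (hj' hj.1)] at this
  exact absurd this (not_lt.mpr (youngExt_nonneg _ _))

open scoped Classical in
/-- In the definition of `ψ` for Young diagrams the product may run over additional empty rows. -/
theorem psiYoung_eq (t : ℝ) {mu lam : YoungDiagram} {M : ℕ} (hM : mu.colLen 0 ≤ M)
    (h : SeqInterlace (youngExt lam) (youngExt mu)) :
    psiYoung t mu lam = ∏ j ∈ Finset.Icc 1 M, ∏ k ∈ Finset.Icc 1 j,
      if youngExt mu (j + 1) < youngExt lam j ∧ youngExt lam j = youngExt lam k ∧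
        youngExt lam k < youngExt mu k then 1 - t ^ (j - k + 1) else 1 := by
  rw [psiYoung, psiSeq, if_pos h]
  refine Finset.prod_subset (Finset.Icc_subset_Icc_right hM) fun j hj hj' => ?_
  simp only [Finset.mem_Icc, not_and, not_le] at hj hj'
  refine Finset.prod_eq_one fun k _ => if_neg fun hc => ?_
  have h1 := hc.1.trans_le (h j hj.1).1
  rw [youngExt_of_lt (lam := mu) (hj' hj.1)] at h1
  exact absurd h1 (not_lt.mpr (youngExt_nonneg _ _))

theorem phi_youngSig (t : ℝ) {nu lam : YoungDiagram} {M : ℕ} (hnu : nu.colLen 0 ≤ M)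
    (hlam : lam.colLen 0 ≤ M) (h : Interlace (youngSig lam M) (youngSig nu M)) :
    phi t (youngSig nu M) (youngSig lam M) = phiYoung t nu lam := by
  classical
  rw [phiYoung_eq t hnu (h.young le_rfl (Nat.le_succ M) hlam hnu), phi, phiSeq,
    if_pos (show SeqInterlace _ _ from h)]
  refine Finset.prod_congr rfl fun j hj => Finset.prod_congr rfl fun k hk => ?_
  rw [Finset.mem_Icc] at hj hk
  rw [youngSig_ext lam hj.2, youngSig_ext nu hj.2, youngSig_ext nu (k := k) (by omega),
    youngSig_ext lam (k := k - 1) (by omega)]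

/-- The additional part `c`, smaller than all other parts, contributes the factor `1 - t` to
`ψ`. -/
theorem psi_append (t : ℝ) {mu lam : YoungDiagram} {N : ℕ} (hmu : mu.colLen 0 ≤ N + 1)
    (hlam : lam.colLen 0 ≤ N) (h : Interlace (youngSig lam N) (youngSig mu (N + 1))) {c : ℤ}
    (hc : ∀ i, c ≤ (youngSig lam N).part i) (hc1 : ∀ i, c < (youngSig lam N).part i)
    (hc2 : ∀ i, c < (youngSig mu (N + 1)).part i) :
    psi t (youngSig mu (N + 1)) ((youngSig lam N).append c hc) =
      psiYoung t mu lam * (1 - t) := by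
  classical
  have hI := h.append_left hc fun i => (hc2 i).le
  have last : ∏ k ∈ Finset.Icc 1 (N + 1), (if youngExt mu (N + 1 + 1) < youngExt lam (N + 1) ∧
      youngExt lam (N + 1) = youngExt lam k ∧ youngExt lam k < youngExt mu k
      then 1 - t ^ (N + 1 - k + 1) else 1) = 1 := by
    refine Finset.prod_eq_one fun k _ => if_neg fun hk => ?_
    have := hk.1
    rw [youngExt_of_lt (lam := lam) (by omega)] at this
    exact absurd this (not_lt.mpr (youngExt_nonneg _ _))
  have last' : ∏ k ∈ Finset.Icc 1 (N + 1), (if (youngSig mu (N + 1)).ext (N + 1 + 1) <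
      ((youngSig lam N).append c hc).ext (N + 1) ∧
      ((youngSig lam N).append c hc).ext (N + 1) = ((youngSig lam N).append c hc).ext k ∧
      ((youngSig lam N).append c hc).ext k < (youngSig mu (N + 1)).ext k
      then 1 - t ^ (N + 1 - k + 1) else 1) = 1 - t := by
    rw [Finset.prod_eq_single (N + 1)]
    · rw [if_pos, Nat.sub_self, zero_add, pow_one]
      rw [Sig.append_ext_last, Sig.ext_of_lt _ (Nat.lt_succ_self _)]
      exact ⟨WithBot.bot_lt_coe _, rfl, Sig.coe_lt_ext _ hc2 le_rfl⟩
    · intro k hk hne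
      rw [Finset.mem_Icc] at hk
      refine if_neg fun hk' => ?_
      have := hk'.2.1
      rw [Sig.append_ext_last, Sig.append_ext_of_le _ hc (by omega)] at this
      exact (Sig.coe_lt_ext _ hc1 (k := k) (by omega)).ne this
    · intro hk
      exact absurd (Finset.mem_Icc.mpr ⟨by omega, le_rfl⟩) hk
  rw [psiYoung_eq t hmu (h.young (Nat.le_succ N) le_rfl hlam hmu),
    Finset.prod_Icc_succ_top (by omega), last, mul_one, psi, psiSeq,
    if_pos (show SeqInterlace _ _ from hI), Finset.prod_Icc_succ_top (by omega), last']
  congr 1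
  refine Finset.prod_congr rfl fun j hj => Finset.prod_congr rfl fun k hk => ?_
  rw [Finset.mem_Icc] at hj hk
  rw [Sig.append_ext_of_le _ hc hj.2, Sig.append_ext_of_le _ hc (k := k) (by omega),
    youngSig_ext lam hj.2, youngSig_ext lam (k := k) (by omega),
    youngSig_ext mu (k := k) (by omega), youngSig_ext mu (k := j + 1) (by omega)]

/-- The additional particle, moving from `a - r` to `a`, contributes the factor `1 - t` to `φ` if it
moves at all. -/
theorem phi_append (t : ℝ) {nu lam : YoungDiagram} {N r : ℕ} {a : ℤ} (hnu : nu.colLen 0 ≤ N)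
    (hlam : lam.colLen 0 ≤ N) (h : Interlace (youngSig lam N) (youngSig nu N))
    (hc : ∀ i, a - r ≤ (youngSig lam N).part i) (hd : ∀ i, a ≤ (youngSig nu N).part i)
    (hc1 : ∀ i, a < (youngSig lam N).part i) (hd1 : ∀ i, a < (youngSig nu N).part i) :
    phi t ((youngSig nu N).append a hd) ((youngSig lam N).append (a - r) hc) =
      phiYoung t nu lam * (1 - if 1 ≤ r then t else 0) := by
  classical
  have hI := h.append (by omega) hc hd fun i => (hc1 i).le
  rw [phiYoung_eq t hnu (h.young le_rfl (Nat.le_succ N) hlam hnu), phi, phiSeq,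
    if_pos (show SeqInterlace _ _ from hI), Finset.prod_Icc_succ_top (by omega)]
  congr 1
  · refine Finset.prod_congr rfl fun j hj => Finset.prod_congr rfl fun k hk => ?_
    rw [Finset.mem_Icc] at hj hk
    rw [Sig.append_ext_of_le _ hc hj.2, Sig.append_ext_of_le _ hc (k := k - 1) (by omega),
      Sig.append_ext_of_le _ hd hj.2, Sig.append_ext_of_le _ hd (k := k) (by omega),
      youngSig_ext lam hj.2, youngSig_ext lam (k := k - 1) (by omega),
      youngSig_ext nu hj.2, youngSig_ext nu (k := k) (by omega)]
  · rw [Finset.prod_eq_single (N + 1)]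
    · rw [Sig.append_ext_last, Sig.append_ext_last, Nat.add_sub_cancel,
        Sig.append_ext_of_le _ hc le_rfl, Nat.sub_self, zero_add, pow_one]
      have h1 := Sig.coe_lt_ext _ hc1 le_rfl
      by_cases hr : 1 ≤ r
      · rw [if_pos ⟨(Sig.coe_lt_coe_ext _ _).mpr (by omega), rfl, h1⟩, if_pos hr]
      · rw [if_neg (fun h => by have := (Sig.coe_lt_coe_ext _ _).mp h.1; omega), if_neg hr,
          sub_zero]
    · intro k hk hne
      rw [Finset.mem_Icc] at hk
      refine if_neg fun hk' => ?_
      have := hk'.2.1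
      rw [Sig.append_ext_last, Sig.append_ext_of_le _ hd (by omega)] at this
      exact (Sig.coe_lt_ext _ hd1 (k := k) (by omega)).ne this
    · intro hk
      exact absurd (Finset.mem_Icc.mpr ⟨by omega, le_rfl⟩) hk

/-- If `λ ≺ μ` with one more part in `μ`, a strict lower bound of `μ` is one of `λ`. -/
theorem Interlace.lt_part {N : ℕ} {lam : Sig N} {mu : Sig (N + 1)} (h : Interlace lam mu) {a : ℤ}
    (ha : ∀ i, a < mu.part i) (i : Fin N) : a < lam.part i := by
  have h1 := (h (i + 1) (by omega)).2
  have h2 := mu.ext_succ i.succ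
  rw [Fin.val_succ] at h2
  rw [h2, Sig.ext_succ, Sig.coe_le_coe_ext] at h1
  exact (ha _).trans_le h1

end HLRSK

/-- The flip property of the Hall-Littlewood RSK weights, for signatures and for Young diagrams. -/
theorem mainTheorem2 (t : ℝ) (ht0 : 0 ≤ t) (ht1 : t < 1) :
    (∀ (N : ℕ) (lam mu nu rho : HLRSK.Sig N),
      (HLRSK.Interlace mu rho → HLRSK.Interlace nu rho →
        HLRSK.phi t rho mu * HLRSK.psi t rho nu ≠ 0) ∧
      HLRSK.U t mu rho lam nu *
          ((HLRSK.phi t nu lam * HLRSK.psi t mu lam) /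
            (HLRSK.phi t rho mu * HLRSK.psi t rho nu)) =
        HLRSK.U t nu.neg lam.neg rho.neg mu.neg) ∧
    (∀ (lam mu nu rho : YoungDiagram) (r N : ℕ) (a : ℤ),
      lam.colLen 0 ≤ N → nu.colLen 0 ≤ N → mu.colLen 0 ≤ N + 1 → rho.colLen 0 ≤ N + 1 →
      (∀ i, a < (HLRSK.youngSig mu (N + 1)).part i) → (∀ i, a < (HLRSK.youngSig nu N).part i) →
      (1 - if 1 ≤ r then t else 0) * HLRSK.phiYoung t nu lam * HLRSK.psiYoung t mu lam *
          HLRSK.UInput t r a (HLRSK.youngSig mu (N + 1)) (HLRSK.youngSig rho (N + 1))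
            (HLRSK.youngSig lam N) (HLRSK.youngSig nu N) =
        HLRSK.phiYoung t rho mu * HLRSK.psiYoung t rho nu *
          HLRSK.UHatInput t r a (HLRSK.youngSig nu N) (HLRSK.youngSig lam N)
            (HLRSK.youngSig rho (N + 1)) (HLRSK.youngSig mu (N + 1))) := by
  refine ⟨fun N lam mu nu rho => ?_, fun lam mu nu rho r N a hlam hnu hmu hrho _ _ => ?_⟩
  · have hne : HLRSK.Interlace mu rho → HLRSK.Interlace nu rho →
        HLRSK.phi t rho mu * HLRSK.psi t rho nu ≠ 0 := fun h1 h2 =>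
      mul_ne_zero (HLRSK.phi_ne_zero ht0 ht1 h1) (HLRSK.psi_ne_zero ht0 ht1 h2)
    refine ⟨hne, ?_⟩
    by_cases h : HLRSK.Interlace mu rho ∧ HLRSK.Interlace nu rho
    · rw [← mul_div_assoc, div_eq_iff (hne h.1 h.2)]
      exact HLRSK.U_mul_flip ht0 ht1 mu rho lam nu
    · have h1 : HLRSK.U t mu rho lam nu = 0 := by
        rw [HLRSK.U, dif_neg]
        rintro ⟨⟨-, -, h2, h3, -⟩, -⟩
        exact h ⟨h3, h2⟩
      have h2 : HLRSK.U t nu.neg lam.neg rho.neg mu.neg = 0 := by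
        rw [HLRSK.U, dif_neg]
        rintro ⟨⟨h2, h3, -⟩, -⟩
        exact h ⟨by simpa using h2.neg, by simpa using h3.neg⟩
      rw [h1, h2, zero_mul]
  · by_cases h : HLRSK.InputCond r a (HLRSK.youngSig mu (N + 1)) (HLRSK.youngSig rho (N + 1))
      (HLRSK.youngSig lam N) (HLRSK.youngSig nu N)
    · rw [HLRSK.UInput, HLRSK.UHatInput, dif_pos h, dif_pos h]
      have la := h.lam_mu.lt_part h.lt_mu
      have lr : ∀ i, a < (HLRSK.youngSig rho (N + 1)).part i := fun i =>
        (h.lt_mu i).trans_le ((HLRSK.interlace_iff_part.mp h.mu_rho).1 i)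
      have key := HLRSK.U_mul_flip ht0 ht1 (HLRSK.youngSig mu (N + 1))
        (HLRSK.youngSig rho (N + 1)) ((HLRSK.youngSig lam N).append (a - r) h.le_lam)
        ((HLRSK.youngSig nu N).append a h.le_nu)
      rw [HLRSK.phi_append t hnu hlam h.lam_nu h.le_lam h.le_nu la h.lt_nu,
        HLRSK.psi_append t hmu hlam h.lam_mu h.le_lam
          (fun i => (Int.sub_le_self a (Int.natCast_nonneg r)).trans_lt (la i))
          (fun i => (Int.sub_le_self a (Int.natCast_nonneg r)).trans_lt (h.lt_mu i)),
        HLRSK.psi_append t hrho hnu h.nu_rho h.le_nu h.lt_nu lr,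
        HLRSK.phi_youngSig t hrho hmu h.mu_rho] at key
      -- The additional part contributes `1 - t` to both values of `ψ`.
      refine mul_right_cancel₀ (b := 1 - t) (by linarith) ?_
      linear_combination key
    · rw [HLRSK.UInput, HLRSK.UHatInput, dif_neg h, dif_neg h, mul_zero, mul_zero]
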